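/- Let $T\in(0,\infty)$ and let $H$ be a real Hilbert space. For each $t\in[0,T]$ let $\varphi^t:H\to(-\infty,\infty]$ be proper, lower semicontinuous and convex, with effective domain $D(\varphi^t)=\{w\in H:\varphi^t(w)<\infty\}$, subdifferential $\partial\varphi^t(z)=\{\xi\in H:\varphi^t(v)-\varphi^t(z)\ge(\xi,v-z)_H\ \text{for all } v\in D(\varphi^t)\}$ and $D(\partial\varphi^t)=\{w\in D(\varphi^t):\partial\varphi^t(w)\ne\emptyset\}$. Assume: (A1) There is $c_1\ge 0$ such that for all $0\le s\le t\le T$ and $z\in D(\varphi^s)$ there is $z'\in D(\varphi^t)$ with $$\|z'-z\|_H\le c_1|t-s|\,(1+|\varphi^s(z)|)^{1/2},\qquad \varphi^t(z')\le\varphi^s(z)+c_1|t-s|\,(1+|\varphi^s(z)|).$$ (A2) There is $c_2\ge 0$ such that for every $u\in L^2(0,T;H)$ with $\varphi^\bullet(u(\bullet))\in L^1(0,T)$ and every $t\in(0,T)$ there is $w_t\in L^2(0,t;H)$ with, for a.e. $s\in(0,t)$, $$\|w_t(s)-u(s)\|_H\le c_2|t-s|\,(1+|\varphi^s(u(s))|)^{1/2},\qquad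 \varphi^t(w_t(s))\le\varphi^s(u(s))+c_2|t-s|\,(1+|\varphi^s(u(s))|).$$ Write $(k*w)(t)=\int_0^t k(t-s)w(s)\,ds$. We say $(k,\ell)\in PC$ if $k,\ell\in L^1_{\rm loc}([0,\infty))$ are nonnegative and nonincreasing and $(k*\ell)(t)=1$ for all $t>0$. For such a pair let $$D(\mathcal B)=\{w\in L^2(0,T;H): k*w\in W^{1,2}(0,T;H),\ (k*w)(0)=0\},\qquad \mathcal B(w)=\partial_t(k*w),$$ where $(k*w)(0)$ is the value at $0$ of the continuous representative. Then there is a constant $c\ge 0$ such that for every $(k,\ell)\in PC$, every $u_0\in D(\varphi^0)$ and all $u,g\in L^2(0,T;H)$ with $u-u_0\in D(\mathcal B)$, $\varphi^\bullet(u(\bullet))\in L^1(0,T)$, and $u(t)\in D(\partial\varphi^t)$, $g(t)\in\partial\varphi^t(u(t))$ for a.e. $t\in(0,T)$, the following holds for every $t\in(0,T]$: the integral defining $[k*\varphi^\bullet(u(\bullet))](t)$ converges absolutely, and for all $\varepsilon\in(0,1)$ $$\begin{aligned}\int_0^t\bigl(\partial_t[k*(u-u_0)](s),g(s)\bigr)_H\,ds\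 \ge\ &[k*\varphi^\bullet(u(\bullet))](t)-\varphi^0(u_0)\int_0^tk(s)\,ds-\varepsilon c\,\|k\|_{L^1(0,T)}\int_0^t\|g(s)\|_H^2\,ds\\&-\frac c\varepsilon\,t\,\|k\|_{L^1(0,T)}\bigl(1+|\varphi^0(u_0)|\bigr)-\frac c\varepsilon\,\|k\|_{L^1(0,T)}\int_0^t|\varphi^s(u(s))|\,ds.\end{aligned}$$ In particular, for every $(k,\ell)\in PC$ there is a constant $C\ge 0$ such that for all $u_0,u,g$ as above, all $\varepsilon\in(0,1)$ and all $t\in(0,T]$ $$\begin{aligned}\int_0^t\bigl(\partial_t[k*(u-u_0)](s),g(s)\bigr)_H\,ds\ \ge\ &[k*\varphi^\bullet(u(\bullet))](t)-\varphi^0(u_0)\int_0^tk(s)\,ds-\varepsilon C\int_0^t\|g(s)\|_H^2\,ds\\&-\frac C\varepsilon\Bigl[T\bigl(1+|\varphi^0(u_0)|\bigr)+\int_0^t|\varphi^s(u(s))|\,ds\Bigr].\end{aligned}$$ -/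

import Mathlib

open MeasureTheory Set Filter Topology
open scoped ContDiff

namespace NonlocalChainRule

/-! ### Convex functionals with values in `(-∞, ∞]` -/

section Convex

variable {H : Type*} [NormedAddCommGroup H] [InnerProductSpace ℝ H]

/-- The effective domain `D(ψ) = {w : ψ(w) < ∞}`. -/
def effDomain (ψ : H → EReal) : Set H := {w | ψ w < ⊤}

/-- `ψ : H → (-∞, ∞]` is proper, lower semicontinuous and convex. -/
structure IsProperLscConvex (ψ : H → EReal) : Prop where
  ne_bot : ∀ w, ψ w ≠ ⊥
  proper : (effDomain ψ).Nonempty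
  lsc : LowerSemicontinuous ψ
  convex : ∀ x y : H, ∀ a b : ℝ, 0 ≤ a → 0 ≤ b → a + b = 1 →
    ψ (a • x + b • y) ≤ (a : EReal) * ψ x + (b : EReal) * ψ y

/-- The subdifferential `∂ψ(z)`: all `ξ` with `ψ(v) - ψ(z) ≥ (ξ, v - z)` for all `v ∈ D(ψ)`.
It is empty when `ψ(z) = ∞` and `ψ` is proper. -/
def subdiff (ψ : H → EReal) (z : H) : Set H :=
  {ξ | ∀ v ∈ effDomain ψ, ψ z + ((inner ℝ ξ (v - z) : ℝ) : EReal) ≤ ψ v}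

/-- The domain `D(∂ψ)`. -/
def subdiffDomain (ψ : H → EReal) : Set H := {w | w ∈ effDomain ψ ∧ (subdiff ψ w).Nonempty}

end Convex

/-! ### Functions on `(0, T)` -/

/-- Lebesgue measure on the interval `(0, T)`. -/
noncomputable def timeMeasure (T : ℝ) : Measure ℝ := volume.restrict (Ioo 0 T)

section Bochner

variable {H : Type*} [NormedAddCommGroup H] [NormedSpace ℝ H]

/-- The convolution `(k * w)(t) = ∫₀ᵗ k(t - s) w(s) ds`. -/
noncomputable def conv (k : ℝ → ℝ) (w : ℝ → H) (t : ℝ) : H :=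
  ∫ s in (0 : ℝ)..t, k (t - s) • w s

/-- `h` is the weak derivative of `v` on `(0, T)`, tested with `C_c^∞(0, T)`. -/
def IsWeakDeriv (T : ℝ) (v h : ℝ → H) : Prop :=
  ∀ η : ℝ → ℝ, ContDiff ℝ ∞ η → HasCompactSupport η → tsupport η ⊆ Ioo 0 T →
    ∫ t in (0 : ℝ)..T, deriv η t • v t = -∫ t in (0 : ℝ)..T, η t • h t

/-- `v ∈ W^{1,2}(0, T; H)`. -/
def MemW12 (T : ℝ) (v : ℝ → H) : Prop :=
  MemLp v 2 (timeMeasure T) ∧ ∃ h : ℝ → H, MemLp h 2 (timeMeasure T) ∧ IsWeakDeriv T v h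

/-- `v(0) = a` for a function known up to null sets: `v` agrees a.e. on `(0, T)` with a function
continuous on `[0, T]` whose value at `0` is `a`. -/
def HasInitialValue (T : ℝ) (v : ℝ → H) (a : H) : Prop :=
  ∃ v' : ℝ → H, ContinuousOn v' (Icc 0 T) ∧ v =ᵐ[timeMeasure T] v' ∧ v' 0 = a

open Classical in
/-- The weak derivative `∂ₜ v ∈ L²(0, T; H)` of `v ∈ W^{1,2}(0, T; H)`
(a representative of this class). -/
noncomputable def timeDeriv (T : ℝ) (v : ℝ → H) : ℝ → H :=
  if hv : MemW12 T v then Classical.choose hv.2 else 0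

/-- The domain `D(𝓑)` of the nonlocal time-differential operator `𝓑(w) = ∂ₜ(k * w)`. -/
def MemDomB (T : ℝ) (k : ℝ → ℝ) (w : ℝ → H) : Prop :=
  MemLp w 2 (timeMeasure T) ∧ MemW12 T (conv k w) ∧ HasInitialValue T (conv k w) 0

/-- The nonlocal time-differential operator `𝓑(w) = ∂ₜ(k * w)`. -/
noncomputable def opB (T : ℝ) (k : ℝ → ℝ) (w : ℝ → H) : ℝ → H := timeDeriv T (conv k w)

end Bochner

/-- `(k, ℓ) ∈ PC`. -/
structure IsPC (k l : ℝ → ℝ) : Prop where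
  locInt_k : LocallyIntegrableOn k (Ici 0)
  nonneg_k : ∀ t, 0 < t → 0 ≤ k t
  antitone_k : AntitoneOn k (Ioi 0)
  locInt_l : LocallyIntegrableOn l (Ici 0)
  nonneg_l : ∀ t, 0 < t → 0 ≤ l t
  antitone_l : AntitoneOn l (Ioi 0)
  conv_eq_one : ∀ t, 0 < t → conv k l t = 1

section TimeDependent

variable {H : Type*} [NormedAddCommGroup H] [InnerProductSpace ℝ H]

/-- The real function `s ↦ φˢ(u(s))`, used only where `φˢ(u(s))` is finite. -/
noncomputable def along (φ : ℝ → H → EReal) (u : ℝ → H) (s : ℝ) : ℝ := (φ s (u s)).toReal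

/-- `φ^•(u(•)) ∈ L¹(0, T)`. -/
def MemL1Along (T : ℝ) (φ : ℝ → H → EReal) (u : ℝ → H) : Prop :=
  (∀ᵐ s ∂(timeMeasure T), u s ∈ effDomain (φ s)) ∧ Integrable (along φ u) (timeMeasure T)

/-- The Kenmochi condition (A1). -/
def CondA1 (T : ℝ) (φ : ℝ → H → EReal) : Prop :=
  ∃ c₁ : ℝ, 0 ≤ c₁ ∧ ∀ s ∈ Icc (0 : ℝ) T, ∀ t ∈ Icc (0 : ℝ) T, s ≤ t →
    ∀ z ∈ effDomain (φ s), ∃ z' ∈ effDomain (φ t),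
      ‖z' - z‖ ≤ c₁ * |t - s| * Real.sqrt (1 + |(φ s z).toReal|) ∧
      φ t z' ≤ (((φ s z).toReal + c₁ * |t - s| * (1 + |(φ s z).toReal|) : ℝ) : EReal)

/-- The condition (A2). -/
def CondA2 (T : ℝ) (φ : ℝ → H → EReal) : Prop :=
  ∃ c₂ : ℝ, 0 ≤ c₂ ∧ ∀ u : ℝ → H, MemLp u 2 (timeMeasure T) → MemL1Along T φ u →
    ∀ t ∈ Ioo (0 : ℝ) T, ∃ w : ℝ → H, MemLp w 2 (timeMeasure t) ∧
      ∀ᵐ s ∂(timeMeasure t),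
        ‖w s - u s‖ ≤ c₂ * |t - s| * Real.sqrt (1 + |along φ u s|) ∧
        φ t (w s) ≤ ((along φ u s + c₂ * |t - s| * (1 + |along φ u s|) : ℝ) : EReal)

end TimeDependent

end NonlocalChainRule

/-! The kernel `k` may be singular at `0`, so it is replaced by the average `k_δ(t) = δ⁻¹ ∫_t^{t+δ}
k` (`shiftAvg`), which is continuous on `[0, T]` and has derivative `-p_δ` in the integrated sense,
where `p_δ = δ⁻¹ (k - k(· + δ)) ≥ 0` (`shiftDecr`). With `w = u - u₀`, `∂ₜ(k_δ * w)(s) = k_δ(0) w(s)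
- (p_δ * w)(s) = k_δ(s) w(s) + ∫₀ˢ p_δ(s - r) (w(s) - w(r)) dr`. All weights are nonnegative. Hence
it suffices to bound `(u(s) - u₀, g(s))` and `(u(s) - u(r), g(s))` from below. Condition (A1) moves
`u₀` or `u(r)` into `D(φˢ)`, where the subgradient inequality applies; this gives the difference of
the energies minus an error proportional to the elapsed time (`CondA1With.inner_ge`). The energy
terms reassemble into `∂ₜ(k_δ * ψ) - φ⁰(u₀) k_δ` with `ψ = φ^•(u(•))`. The errors carry the weights
`s k_δ(s)` and `∫₀ˢ r p_δ(r) dr`, both at most `∫₀ˢ k`, so only the `L¹` norm of `k` enters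
(`IsPC.shiftAvg_inequality`).

To let `δ → 0`, put `f = ∂ₜ(k * w)`. Then `w = ℓ * f`, and `∂ₜ(k_δ * w) = q_δ * f` with `q_δ =
∂ₜ(k_δ * ℓ)` (`approxKernel`). Monotonicity of `ℓ` gives `q_δ ≥ 0`, and `∫₀ᵗ q_δ = (k_δ * ℓ)(t) → (k
* ℓ)(t) = 1` for every `t > 0`. So `q_δ` is an approximate identity, and `∫ (q_δ * f, g) → ∫ (f, g)`
(`tendsto_integral_inner_conv`).

Absolute convergence of `(k * ψ)(t)` at every `t`, not just almost every `t`, follows from Fatou's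
lemma: the regularized inequality bounds `(k_δ * ψ)(t)` from above, and a minorant of `ψ` is
supplied by (A1) and the linear lower bound of convex functionals (`exists_minorant`). -/

namespace NonlocalChainRule

/-! ### Convolution on a finite interval: identities almost everywhere and at every point -/

section Convolution

variable {H : Type*} [NormedAddCommGroup H] [NormedSpace ℝ H]

open scoped Convolution
open ContinuousLinearMap (lsmul mul)

theorem timeMeasure_mono {s t : ℝ} (h : s ≤ t) : timeMeasure s ≤ timeMeasure t :=
  Measure.restrict_mono (Ioo_subset_Ioo_right h) le_rfl

theorem intervalIntegral_eq_timeMeasure {t : ℝ} (ht : 0 ≤ t) (f : ℝ → H) :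
    ∫ s in (0 : ℝ)..t, f s = ∫ s, f s ∂(timeMeasure t) := by
  rw [intervalIntegral.integral_of_le ht, integral_Ioc_eq_integral_Ioo, timeMeasure]

theorem intervalIntegrable_iff_timeMeasure {E : Type*} [NormedAddCommGroup E] {t : ℝ} (ht : 0 ≤ t) (f : ℝ → E) :
    IntervalIntegrable f volume 0 t ↔ Integrable f (timeMeasure t) := by
  rw [intervalIntegrable_iff_integrableOn_Ioo_of_le ht, timeMeasure, IntegrableOn]

theorem ae_timeMeasure_iff {t : ℝ} {P : ℝ → Prop} :
    (∀ᵐ s ∂(timeMeasure t), P s) ↔ ∀ᵐ s, s ∈ Ioo 0 t → P s :=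
  ae_restrict_iff' measurableSet_Ioo

theorem ae_mem_timeMeasure (t : ℝ) : ∀ᵐ s ∂(timeMeasure t), s ∈ Ioo 0 t :=
  ae_restrict_mem measurableSet_Ioo

instance (T : ℝ) : IsFiniteMeasure (timeMeasure T) := by
  unfold timeMeasure; infer_instance

theorem integrable_timeMeasure_iff {E : Type*} [NormedAddCommGroup E] {t : ℝ} {f : ℝ → E} :
    Integrable f (timeMeasure t) ↔ Integrable ((Ioo 0 t).indicator f) := by
  rw [timeMeasure, integrable_indicator_iff measurableSet_Ioo, IntegrableOn]

theorem ae_timeMeasure_reflect {t : ℝ} {P : ℝ → Prop} (h : ∀ᵐ s ∂(timeMeasure t), P s) :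
    ∀ᵐ s ∂(timeMeasure t), P (t - s) := by
  rw [ae_timeMeasure_iff] at h ⊢
  have := (Measure.measurePreserving_sub_left volume t).quasiMeasurePreserving.ae h
  filter_upwards [this] with s hs hst
  exact hs ⟨by linarith [hst.2], by linarith [hst.1]⟩

theorem ae_timeMeasure_mono {s t : ℝ} (hst : s ≤ t) {P : ℝ → Prop}
    (h : ∀ᵐ r ∂(timeMeasure t), P r) : ∀ᵐ r ∂(timeMeasure s), P r :=
  ae_mono (timeMeasure_mono hst) h

theorem indicator_conv_integrand {T t : ℝ} (htT : t ≤ T) (a : ℝ → ℝ) (c : ℝ → H) :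
    (fun s => (Ioo 0 T).indicator a (t - s) • (Ioo 0 T).indicator c s)
      = (Ioo 0 t).indicator fun s => a (t - s) • c s := by
  funext s
  by_cases hs : s ∈ Ioo 0 t
  · rw [indicator_of_mem hs, indicator_of_mem, indicator_of_mem]
    · exact ⟨hs.1, hs.2.trans_le htT⟩
    · exact ⟨by linarith [hs.2], by linarith [hs.1]⟩
  · rw [indicator_of_notMem hs]
    by_cases h0 : 0 < s
    · rw [indicator_of_notMem (fun h => hs ⟨h0, by linarith [h.1]⟩), zero_smul]
    · rw [indicator_of_notMem (a := s) (fun h => h0 h.1), smul_zero]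

/-- For `t ≤ T`, cutting both factors off to `(0, T)` leaves exactly `0 < s < t` in the integrand,
so the theory of convolution on the line applies. -/
theorem conv_eq_convolution {T t : ℝ} (ht : 0 ≤ t) (htT : t ≤ T) (a : ℝ → ℝ) (c : ℝ → H) :
    conv a c t = ((Ioo 0 T).indicator a ⋆[lsmul ℝ ℝ, volume] (Ioo 0 T).indicator c) t := by
  rw [convolution_lsmul_swap, indicator_conv_integrand htT,
    integral_indicator measurableSet_Ioo, conv, intervalIntegral_eq_timeMeasure ht, timeMeasure]

theorem convolution_indicator_of_nonpos {T t : ℝ} (ht : t ≤ 0) (a : ℝ → ℝ) (c : ℝ → H) :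
    ((Ioo 0 T).indicator a ⋆[lsmul ℝ ℝ, volume] (Ioo 0 T).indicator c) t = 0 := by
  rcases le_or_gt t T with h | h
  · rw [convolution_lsmul_swap, indicator_conv_integrand h, Ioo_eq_empty (by linarith)]
    simp
  · rw [Ioo_eq_empty (by linarith)]
    simp [convolution_def]

theorem convolutionExistsAt_indicator_iff {T t : ℝ} (ht : 0 ≤ t) (htT : t ≤ T)
    (a : ℝ → ℝ) (c : ℝ → H) :
    ConvolutionExistsAt ((Ioo 0 T).indicator a) ((Ioo 0 T).indicator c) t (lsmul ℝ ℝ) volume ↔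
      IntervalIntegrable (fun s => a (t - s) • c s) volume 0 t := by
  rw [convolutionExistsAt_iff_integrable_swap, intervalIntegrable_iff_timeMeasure ht,
    integrable_timeMeasure_iff, ← indicator_conv_integrand htT]
  rfl

theorem conv_comm (a c : ℝ → ℝ) (t : ℝ) : conv a c t = conv c a t := by
  have := intervalIntegral.integral_comp_sub_left (fun s => a (t - s) • c s) t (a := 0) (b := t)
  simp only [sub_sub_cancel, sub_self, sub_zero] at this
  rw [conv, ← this, conv]
  simp [mul_comm]

theorem ae_intervalIntegrable_conv {T : ℝ} {a : ℝ → ℝ} {c : ℝ → H}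
    (ha : Integrable a (timeMeasure T)) (hc : Integrable c (timeMeasure T)) :
    ∀ᵐ t ∂(timeMeasure T), IntervalIntegrable (fun s => a (t - s) • c s) volume 0 t := by
  rw [integrable_timeMeasure_iff] at ha hc
  rw [ae_timeMeasure_iff]
  filter_upwards [Integrable.ae_convolution_exists (lsmul ℝ ℝ) ha hc] with t ht htT
  exact (convolutionExistsAt_indicator_iff htT.1.le htT.2.le a c).1 ht

theorem integrable_conv {T : ℝ} {a : ℝ → ℝ} {c : ℝ → H}
    (ha : Integrable a (timeMeasure T)) (hc : Integrable c (timeMeasure T)) :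
    Integrable (conv a c) (timeMeasure T) := by
  rw [integrable_timeMeasure_iff] at ha hc
  have h := (Integrable.integrable_convolution (lsmul ℝ ℝ) ha hc).mono_measure
    (Measure.restrict_le_self (s := Ioo 0 T))
  refine h.congr ?_
  filter_upwards [ae_mem_timeMeasure T] with t ht
  exact (conv_eq_convolution ht.1.le ht.2.le a c).symm

theorem conv_congr_right {T t : ℝ} (ht : 0 ≤ t) (htT : t ≤ T) {a : ℝ → ℝ} {c d : ℝ → H}
    (h : c =ᵐ[timeMeasure T] d) : conv a c t = conv a d t := by
  rw [conv, conv, intervalIntegral_eq_timeMeasure ht, intervalIntegral_eq_timeMeasure ht]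
  refine integral_congr_ae ?_
  filter_upwards [ae_timeMeasure_mono htT h] with s hs
  rw [hs]

theorem conv_congr_left {T t : ℝ} (ht : 0 ≤ t) (htT : t ≤ T) {a b : ℝ → ℝ} {c : ℝ → H}
    (h : a =ᵐ[timeMeasure T] b) : conv a c t = conv b c t := by
  rw [conv, conv, intervalIntegral_eq_timeMeasure ht, intervalIntegral_eq_timeMeasure ht]
  refine integral_congr_ae ?_
  filter_upwards [ae_timeMeasure_reflect (ae_timeMeasure_mono htT h)] with s hs
  rw [hs]

theorem conv_one (c : ℝ → H) (t : ℝ) : conv (fun _ => 1) c t = ∫ s in (0 : ℝ)..t, c s := by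
  simp [conv]

theorem conv_conv_of_exists [CompleteSpace H] {T t : ℝ} (ht : 0 ≤ t) (htT : t ≤ T)
    {a b : ℝ → ℝ} {c : ℝ → H}
    (ha : Integrable a (timeMeasure T)) (hb : Integrable b (timeMeasure T))
    (hc : Integrable c (timeMeasure T))
    (hex : ConvolutionExistsAt (fun x => ‖(Ioo 0 T).indicator a x‖)
      ((fun x => ‖(Ioo 0 T).indicator b x‖) ⋆[mul ℝ ℝ, volume]
        fun x => ‖(Ioo 0 T).indicator c x‖) t (mul ℝ ℝ) volume) :
    conv (conv a b) c t = conv a (conv b c) t := by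
  rw [integrable_timeMeasure_iff] at ha hb hc
  have h := convolution_assoc (lsmul ℝ ℝ) (lsmul ℝ ℝ) (lsmul ℝ ℝ) (lsmul ℝ ℝ)
    (μ := volume) (ν := volume) (f := (Ioo 0 T).indicator a) (g := (Ioo 0 T).indicator b)
    (k := (Ioo 0 T).indicator c) (x₀ := t)
    (fun x y z => by simp [smul_smul, mul_comm]) ha.aestronglyMeasurable hb.aestronglyMeasurable
    hc.aestronglyMeasurable (Integrable.ae_convolution_exists _ ha hb)
    (Integrable.ae_convolution_exists _ hb.norm hc.norm) hex
  rw [conv_eq_convolution ht htT, conv_eq_convolution ht htT, convolution_lsmul_swap,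
    convolution_lsmul_swap]
  rw [convolution_lsmul_swap, convolution_lsmul_swap] at h
  convert h using 2
  · funext s
    by_cases hs : s ∈ Ioo 0 T
    · by_cases hst : 0 < t - s
      · rw [indicator_of_mem (show t - s ∈ Ioo 0 T from ⟨hst, by linarith [hs.1]⟩),
          conv_eq_convolution (T := T) hst.le (by linarith [hs.1])]
      · rw [convolution_indicator_of_nonpos (not_lt.1 hst),
          indicator_of_notMem (fun h => hst h.1)]
    · rw [indicator_of_notMem hs, smul_zero, smul_zero]
  · funext s
    by_cases hs : 0 < s
    · by_cases hsT : s < T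
      · rw [indicator_of_mem (show s ∈ Ioo 0 T from ⟨hs, hsT⟩),
          conv_eq_convolution (T := T) hs.le hsT.le]
      · rw [indicator_of_notMem (a := t - s) (fun h => hsT (by linarith [h.1])), zero_smul,
          zero_smul]
    · rw [convolution_indicator_of_nonpos (not_lt.1 hs),
          indicator_of_notMem (a := s) (fun h => hs h.1)]

theorem ae_conv_conv [CompleteSpace H] {T : ℝ} {a b : ℝ → ℝ} {c : ℝ → H}
    (ha : Integrable a (timeMeasure T)) (hb : Integrable b (timeMeasure T))
    (hc : Integrable c (timeMeasure T)) :
    ∀ᵐ t ∂(timeMeasure T), conv (conv a b) c t = conv a (conv b c) t := by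
  have ha' := integrable_timeMeasure_iff.1 ha
  have hb' := integrable_timeMeasure_iff.1 hb
  have hc' := integrable_timeMeasure_iff.1 hc
  rw [ae_timeMeasure_iff]
  filter_upwards [Integrable.ae_convolution_exists (mul ℝ ℝ) ha'.norm
    (Integrable.integrable_convolution (mul ℝ ℝ) hb'.norm hc'.norm)] with t ht htT
  exact conv_conv_of_exists htT.1.le htT.2.le ha hb hc ht

/-- Fubini yields associativity only almost everywhere; a bounded outer factor gives it at every
`t`, because the remaining convolution is integrable. -/
theorem conv_conv_of_bound [CompleteSpace H] {T t C : ℝ} (ht : 0 ≤ t) (htT : t ≤ T)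
    {a b : ℝ → ℝ} {c : ℝ → H} (ha : Integrable a (timeMeasure T)) (hC : ∀ x ∈ Ioo 0 T, ‖a x‖ ≤ C)
    (hb : Integrable b (timeMeasure T)) (hc : Integrable c (timeMeasure T)) :
    conv (conv a b) c t = conv a (conv b c) t := by
  have ha' := integrable_timeMeasure_iff.1 ha
  have hb' := integrable_timeMeasure_iff.1 hb
  have hc' := integrable_timeMeasure_iff.1 hc
  refine conv_conv_of_exists ht htT ha hb hc ?_
  have hi := Integrable.integrable_convolution (mul ℝ ℝ) hb'.norm hc'.norm
  rw [convolutionExistsAt_iff_integrable_swap]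
  refine Integrable.bdd_mul hi (c := |C|) ?_ ?_
  · refine AEStronglyMeasurable.norm ?_
    exact ha'.aestronglyMeasurable.comp_quasiMeasurePreserving
      (Measure.measurePreserving_sub_left volume t).quasiMeasurePreserving
  · refine ae_of_all _ fun s => ?_
    rw [norm_norm]
    by_cases hs : t - s ∈ Ioo 0 T
    · rw [indicator_of_mem hs]
      exact (hC _ hs).trans (le_abs_self C)
    · rw [indicator_of_notMem hs, norm_zero]
      exact abs_nonneg C

/-- Integration is convolution with `1`, so this is associativity with the bounded outer factor `1`.
-/
theorem integral_conv [CompleteSpace H] {T t : ℝ} (ht : 0 ≤ t) (htT : t ≤ T)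
    {b : ℝ → ℝ} {c : ℝ → H} (hb : Integrable b (timeMeasure T))
    (hc : Integrable c (timeMeasure T)) :
    ∫ s in (0 : ℝ)..t, conv b c s = conv (fun r => ∫ s in (0 : ℝ)..r, b s) c t := by
  rw [← conv_one, ← conv_conv_of_bound (C := 1) ht htT (integrable_const _) (by simp) hb hc]
  congr 1
  funext r
  exact conv_one b r

end Convolution

/-! ### Weak derivatives and the du Bois-Reymond lemma -/

section WeakDerivative

variable {H : Type*} [NormedAddCommGroup H] [NormedSpace ℝ H]

theorem integral_deriv_smul_integral [CompleteSpace H] {T : ℝ} (hT : 0 < T) {h : ℝ → H}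
    (hh : Integrable h (timeMeasure T)) {η : ℝ → ℝ} (hη : ContDiff ℝ ∞ η)
    (hc : HasCompactSupport η) (hs : tsupport η ⊆ Ioo 0 T) :
    ∫ t in (0 : ℝ)..T, deriv η t • (∫ s in (0 : ℝ)..t, h s)
      = -∫ t in (0 : ℝ)..T, η t • h t := by
  have hcd : Continuous (deriv η) := hη.continuous_deriv (by simp)
  obtain ⟨C, hC⟩ := hc.deriv.exists_bound_of_continuous hcd
  have hηT : η T = 0 := image_eq_zero_of_notMem_tsupport fun hmem => lt_irrefl _ (hs hmem).2
  -- Reflecting `η'` turns the pairing into a convolution at `T`. Integration by parts is then `(b *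
  -- 1) * h = b * (1 * h)`, where `(b * 1)(r) = -η(T - r)` because `η(T) = 0`.
  set b : ℝ → ℝ := fun x => deriv η (T - x) with hb
  have hbc : Continuous b := hcd.comp (continuous_const.sub continuous_id)
  have hbi : Integrable b (timeMeasure T) :=
    (intervalIntegrable_iff_timeMeasure hT.le b).1 (hbc.intervalIntegrable _ _)
  have key := conv_conv_of_bound (T := T) (t := T) (a := b) (b := fun _ => 1) (c := h) hT.le le_rfl
    hbi (fun x _ => hC (T - x)) (integrable_const 1) hh
  have hb1 : ∀ r, conv b (fun _ => 1) r = -η (T - r) := by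
    intro r
    rw [conv_comm, conv_one, hb, intervalIntegral.integral_comp_sub_left (fun x => deriv η x),
      intervalIntegral.integral_deriv_eq_sub (fun x _ => hη.differentiable (by simp) x)
        (hcd.intervalIntegrable _ _), sub_zero, hηT, zero_sub]
  have e1 : conv b (conv (fun _ => 1) h) T
      = ∫ t in (0 : ℝ)..T, deriv η t • (∫ s in (0 : ℝ)..t, h s) := by
    simp only [conv, hb, sub_sub_cancel, one_smul]
  rw [← e1, ← key, conv, ← intervalIntegral.integral_neg]
  refine intervalIntegral.integral_congr fun s _ => ?_
  simp [hb1]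

theorem integral_eq_intervalIntegral_of_tsupport {T : ℝ} (hT : 0 < T) {η : ℝ → ℝ}
    (hs : tsupport η ⊆ Ioo 0 T) (V : ℝ → H) :
    ∫ x, η x • V x = ∫ t in (0 : ℝ)..T, η t • V t := by
  rw [intervalIntegral_eq_timeMeasure hT.le, timeMeasure,
    setIntegral_eq_integral_of_forall_compl_eq_zero]
  intro x hx
  rw [image_eq_zero_of_notMem_tsupport fun hmem => hx (hs hmem), zero_smul]

theorem ae_eq_zero_of_integral_smul_eq_zero [CompleteSpace H] {T : ℝ} (hT : 0 < T) {V : ℝ → H}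
    (hV : Integrable V (timeMeasure T))
    (h : ∀ η : ℝ → ℝ, ContDiff ℝ ∞ η → HasCompactSupport η → tsupport η ⊆ Ioo 0 T →
      ∫ t in (0 : ℝ)..T, η t • V t = 0) : ∀ᵐ t ∂(timeMeasure T), V t = 0 := by
  rw [ae_timeMeasure_iff]
  refine isOpen_Ioo.ae_eq_zero_of_integral_contDiff_smul_eq_zero
    (IntegrableOn.locallyIntegrableOn hV) fun η h1 h2 h3 => ?_
  rw [integral_eq_intervalIntegral_of_tsupport hT h3, h η h1 h2 h3]

theorem ae_eq_zero_of_integral_eq_zero [CompleteSpace H] {T : ℝ} (hT : 0 < T) {V : ℝ → H}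
    (hV : Integrable V (timeMeasure T))
    (h : ∀ᵐ t ∂(timeMeasure T), ∫ s in (0 : ℝ)..t, V s = 0) :
    ∀ᵐ t ∂(timeMeasure T), V t = 0 := by
  refine ae_eq_zero_of_integral_smul_eq_zero hT hV fun η h1 h2 h3 => ?_
  rw [← neg_eq_zero, ← integral_deriv_smul_integral hT hV h1 h2 h3,
    intervalIntegral_eq_timeMeasure hT.le]
  refine integral_eq_zero_of_ae ?_
  filter_upwards [h] with t ht
  simp [ht]

/-- The primitive from `0` vanishes to the left of the support and, by the mean-zero condition, to
the right of it, so it is again a test function. -/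
theorem exists_test_antideriv {T : ℝ} {θ : ℝ → ℝ} (hθ : ContDiff ℝ ∞ θ) {α β : ℝ} (hα : 0 < α)
    (hβ : β < T) (hsupp : ∀ x, x ∉ Icc α β → θ x = 0)
    (hint : ∫ x in (0 : ℝ)..T, θ x = 0) :
    ∃ η : ℝ → ℝ, ContDiff ℝ ∞ η ∧ HasCompactSupport η ∧ tsupport η ⊆ Ioo 0 T ∧
      deriv η = θ := by
  have hd : ∀ x, HasDerivAt (fun t => ∫ s in (0 : ℝ)..t, θ s) (θ x) x := fun x =>
    intervalIntegral.integral_hasDerivAt_right (hθ.continuous.intervalIntegrable _ _)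
      (hθ.continuous.stronglyMeasurableAtFilter _ _) hθ.continuous.continuousAt
  have hderiv : deriv (fun t => ∫ s in (0 : ℝ)..t, θ s) = θ := funext fun x => (hd x).deriv
  have hz : ∀ x, x ∉ Icc α β → ∫ s in (0 : ℝ)..x, θ s = 0 := by
    intro x hx
    rcases lt_or_ge x α with h | h
    · rw [intervalIntegral.integral_congr (g := fun _ => 0), intervalIntegral.integral_zero]
      intro y hy
      refine hsupp y fun hy' => ?_
      rcases (mem_uIcc.1 hy) with h' | h' <;> linarith [hy'.1, h'.1, h'.2]
    · have hxβ : β < x := not_le.1 fun h' => hx ⟨h, h'⟩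
      rw [← intervalIntegral.integral_add_adjacent_intervals (b := T)
        (hθ.continuous.intervalIntegrable _ _) (hθ.continuous.intervalIntegrable _ _), hint,
        zero_add, intervalIntegral.integral_congr (g := fun _ => 0),
        intervalIntegral.integral_zero]
      intro y hy
      refine hsupp y fun hy' => ?_
      rcases (mem_uIcc.1 hy) with h' | h' <;> linarith [hy'.2, h'.1, h'.2]
  refine ⟨fun t => ∫ s in (0 : ℝ)..t, θ s, ?_, HasCompactSupport.intro isCompact_Icc hz, ?_,
    hderiv⟩
  · rw [contDiff_infty_iff_deriv, hderiv]
    exact ⟨fun x => (hd x).differentiableAt, hθ⟩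
  · refine (closure_minimal (fun x hx => ?_) isClosed_Icc).trans (Icc_subset_Ioo hα hβ)
    by_contra hx'
    exact hx (hz x hx')

/-- Du Bois-Reymond: with a fixed bump `η₀` of integral `1`, every test function `ζ` equals `(∫ ζ)
η₀` plus the derivative of a test function, so `V` acts like the constant `∫ η₀ V`. -/
theorem ae_eq_const_of_integral_deriv_smul_eq_zero [CompleteSpace H] {T : ℝ} (hT : 0 < T)
    {V : ℝ → H} (hV : Integrable V (timeMeasure T))
    (h : ∀ η : ℝ → ℝ, ContDiff ℝ ∞ η → HasCompactSupport η → tsupport η ⊆ Ioo 0 T →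
      ∫ t in (0 : ℝ)..T, deriv η t • V t = 0) : ∃ a : H, ∀ᵐ t ∂(timeMeasure T), V t = a := by
  let B : ContDiffBump (T / 2) := ⟨T / 8, T / 4, by positivity, by linarith⟩
  set η₀ : ℝ → ℝ := B.normed volume with hη₀
  have hη₀d : ContDiff ℝ ∞ η₀ := B.contDiff_normed
  have hη₀s : tsupport η₀ ⊆ Icc (T / 4) (3 * T / 4) := by
    rw [B.tsupport_normed_eq, Real.closedBall_eq_Icc]
    exact Icc_subset_Icc (by simp [B]; linarith) (by simp [B]; linarith)
  have hη₀T : tsupport η₀ ⊆ Ioo 0 T := hη₀s.trans (Icc_subset_Ioo (by linarith) (by linarith))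
  have hη₀i : ∫ x in (0 : ℝ)..T, η₀ x = 1 := by
    have := integral_eq_intervalIntegral_of_tsupport hT hη₀T (fun _ => (1 : ℝ))
    simp only [smul_eq_mul, mul_one] at this
    rw [← this, hη₀, B.integral_normed]
  have hmul : ∀ ζ : ℝ → ℝ, Continuous ζ → HasCompactSupport ζ →
      IntervalIntegrable (fun t => ζ t • V t) volume 0 T := by
    intro ζ hζ hζc
    obtain ⟨C, hC⟩ := hζc.exists_bound_of_continuous hζ
    exact (intervalIntegrable_iff_timeMeasure hT.le _).2
      (hV.bdd_smul C hζ.aestronglyMeasurable (ae_of_all _ hC))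
  refine ⟨∫ t in (0 : ℝ)..T, η₀ t • V t, ?_⟩
  set a := ∫ t in (0 : ℝ)..T, η₀ t • V t
  have := ae_eq_zero_of_integral_smul_eq_zero hT (V := fun t => V t - a)
    (hV.sub (integrable_const a)) ?_
  · filter_upwards [this] with t ht using sub_eq_zero.1 ht
  intro ζ h1 h2 h3
  set c := ∫ x in (0 : ℝ)..T, ζ x with hc
  have hK : IsCompact (tsupport ζ ∪ Icc (T / 4) (3 * T / 4)) := h2.isCompact.union isCompact_Icc
  have hne : (tsupport ζ ∪ Icc (T / 4) (3 * T / 4)).Nonempty :=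
    ⟨T / 2, Or.inr ⟨by linarith, by linarith⟩⟩
  have hKT : tsupport ζ ∪ Icc (T / 4) (3 * T / 4) ⊆ Ioo 0 T :=
    union_subset h3 (Icc_subset_Ioo (by linarith) (by linarith))
  have hsub : ∀ x, x ∉ Icc (sInf (tsupport ζ ∪ Icc (T / 4) (3 * T / 4)))
      (sSup (tsupport ζ ∪ Icc (T / 4) (3 * T / 4))) → ζ x - c * η₀ x = 0 := by
    intro x hx
    have hx' : x ∉ tsupport ζ ∪ Icc (T / 4) (3 * T / 4) := fun hmem =>
      hx ⟨csInf_le hK.bddBelow hmem, le_csSup hK.bddAbove hmem⟩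
    rw [image_eq_zero_of_notMem_tsupport fun hm => hx' (Or.inl hm),
      image_eq_zero_of_notMem_tsupport fun hm => hx' (Or.inr (hη₀s hm))]
    simp
  have hcη : IntervalIntegrable (fun x => c * η₀ x) volume 0 T :=
    (continuous_const.mul hη₀d.continuous).intervalIntegrable _ _
  have hζa : IntervalIntegrable (fun x => ζ x • a) volume 0 T :=
    (h1.continuous.smul continuous_const).intervalIntegrable _ _
  obtain ⟨η, e1, e2, e3, e4⟩ := exists_test_antideriv (T := T) (θ := fun x => ζ x - c * η₀ x)
    (h1.sub (contDiff_const.mul hη₀d)) (hKT (hK.sInf_mem hne)).1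
    (hKT (hK.sSup_mem hne)).2 hsub (by
      rw [intervalIntegral.integral_sub (h1.continuous.intervalIntegrable _ _) hcη,
        intervalIntegral.integral_const_mul, hη₀i, mul_one, sub_self])
  have h0 := h η e1 e2 e3
  rw [e4] at h0
  have hζV := hmul ζ h1.continuous h2
  have hηV := hmul η₀ hη₀d.continuous B.hasCompactSupport_normed
  simp only [sub_smul, mul_smul] at h0
  have hcV : IntervalIntegrable (fun t => c • η₀ t • V t) volume 0 T := hηV.smul c
  rw [intervalIntegral.integral_sub hζV hcV, intervalIntegral.integral_smul] at h0
  simp only [smul_sub]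
  rw [intervalIntegral.integral_sub hζV hζa, intervalIntegral.integral_smul_const, ← hc]
  exact h0

theorem ae_eq_integral_timeDeriv [CompleteSpace H] {T : ℝ} (hT : 0 < T) {v : ℝ → H}
    (hv : MemW12 T v) (h0 : HasInitialValue T v 0) :
    MemLp (timeDeriv T v) 2 (timeMeasure T) ∧
      ∀ᵐ t ∂(timeMeasure T), v t = ∫ s in (0 : ℝ)..t, timeDeriv T v s := by
  have hsp := Classical.choose_spec hv.2
  have htd : timeDeriv T v = Classical.choose hv.2 := by rw [timeDeriv, dif_pos hv]
  rw [← htd] at hsp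
  obtain ⟨hf, hw⟩ := hsp
  refine ⟨hf, ?_⟩
  set f := timeDeriv T v
  have hfi : Integrable f (timeMeasure T) := hf.integrable (by norm_num)
  have hfii : IntervalIntegrable f volume 0 T := (intervalIntegrable_iff_timeMeasure hT.le f).2 hfi
  have hvi : Integrable v (timeMeasure T) := hv.1.integrable (by norm_num)
  have hcont : ContinuousOn (fun t => ∫ s in (0 : ℝ)..t, f s) (Icc 0 T) := by
    have := intervalIntegral.continuousOn_primitive_interval' hfii left_mem_uIcc
    rwa [uIcc_of_le hT.le] at this
  have hFi : Integrable (fun t => ∫ s in (0 : ℝ)..t, f s) (timeMeasure T) :=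
    (intervalIntegrable_iff_timeMeasure hT.le _).1
      (ContinuousOn.intervalIntegrable (by rwa [uIcc_of_le hT.le]))
  obtain ⟨a, ha⟩ := ae_eq_const_of_integral_deriv_smul_eq_zero hT
    (V := fun t => v t - ∫ s in (0 : ℝ)..t, f s) (hvi.sub hFi) (by
      intro η h1 h2 h3
      have hcd : Continuous (deriv η) := h1.continuous_deriv (by simp)
      obtain ⟨C, hC⟩ := h2.deriv.exists_bound_of_continuous hcd
      have hm : ∀ V : ℝ → H, Integrable V (timeMeasure T) →
          IntervalIntegrable (fun t => deriv η t • V t) volume 0 T := fun V hV =>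
        (intervalIntegrable_iff_timeMeasure hT.le _).2
          (hV.bdd_smul C hcd.aestronglyMeasurable (ae_of_all _ hC))
      simp only [smul_sub]
      rw [intervalIntegral.integral_sub (hm _ hvi) (hm _ hFi), hw η h1 h2 h3,
        integral_deriv_smul_integral hT hfi h1 h2 h3, sub_self])
  obtain ⟨v', hv'c, hvv', hv'0⟩ := h0
  have hae : (fun t => v' t - ∫ s in (0 : ℝ)..t, f s)
      =ᵐ[volume.restrict (Icc 0 T)] fun _ => a := by
    rw [← restrict_Ioo_eq_restrict_Icc]
    filter_upwards [ha, hvv'] with t h1 h2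
    rw [← h1, h2]
  -- Both sides are continuous on `[0, T]`, so the equality holds at `0` too, where the initial
  -- value forces the constant to be `0`.
  have := Measure.eqOn_Icc_of_ae_eq volume hT.ne hae (hv'c.sub hcont) continuousOn_const
    (left_mem_Icc.2 hT.le)
  simp only [hv'0, intervalIntegral.integral_same, sub_zero] at this
  filter_upwards [ha] with t ht
  rw [← this] at ht
  exact sub_eq_zero.1 ht

end WeakDerivative

/-! ### Kernel pairs with `k * ℓ = 1` -/

theorem IsPC.integrable_left {k l : ℝ → ℝ} (h : IsPC k l) (T : ℝ) :
    Integrable k (timeMeasure T) :=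
  (h.locInt_k.integrableOn_compact_subset Icc_subset_Ici_self isCompact_Icc).mono_set
    Ioo_subset_Icc_self

theorem IsPC.symm {k l : ℝ → ℝ} (h : IsPC k l) : IsPC l k where
  locInt_k := h.locInt_l
  nonneg_k := h.nonneg_l
  antitone_k := h.antitone_l
  locInt_l := h.locInt_k
  nonneg_l := h.nonneg_k
  antitone_l := h.antitone_k
  conv_eq_one t ht := by rw [conv_comm, h.conv_eq_one t ht]

/-- Convolution with `ℓ` inverts `w ↦ ∂ₜ(k * w)`: `1 * w = ℓ * (k * w) = ℓ * (1 * f) = 1 * (ℓ * f)`,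
and functions with equal primitives agree a.e. -/
theorem IsPC.ae_eq_conv_of_conv_eq_integral {H : Type*} [NormedAddCommGroup H] [NormedSpace ℝ H]
    [CompleteSpace H] {k l : ℝ → ℝ} (h : IsPC k l) {T : ℝ} (hT : 0 < T)
    {w f : ℝ → H} (hw : Integrable w (timeMeasure T)) (hf : Integrable f (timeMeasure T))
    (hkw : ∀ᵐ t ∂(timeMeasure T), conv k w t = ∫ s in (0 : ℝ)..t, f s) :
    ∀ᵐ t ∂(timeMeasure T), w t = conv l f t := by
  have hk := h.integrable_left T
  have hl := h.symm.integrable_left T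
  have h1 : Integrable (fun _ : ℝ => (1 : ℝ)) (timeMeasure T) := integrable_const 1
  have hlf := integrable_conv hl hf
  have := ae_eq_zero_of_integral_eq_zero hT (V := fun t => w t - conv l f t) (hw.sub hlf) (by
    filter_upwards [ae_conv_conv hl hk hw, ae_conv_conv hl h1 hf, ae_conv_conv h1 hl hf,
      ae_mem_timeMeasure T] with t e1 e2 e3 ht
    have hi : ∀ V : ℝ → H, Integrable V (timeMeasure T) → IntervalIntegrable V volume 0 t :=
      fun V hV => (intervalIntegrable_iff_timeMeasure ht.1.le V).2
        (hV.mono_measure (timeMeasure_mono ht.2.le))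
    rw [intervalIntegral.integral_sub (hi _ hw) (hi _ hlf), sub_eq_zero, ← conv_one w,
      ← conv_one (conv l f), ← e3]
    have e4 : conv (fun _ => 1) w t = conv (conv l k) w t := by
      refine conv_congr_left ht.1.le ht.2.le ?_
      filter_upwards [ae_mem_timeMeasure T] with s hs
      exact (h.symm.conv_eq_one s hs.1).symm
    have e5 : conv l (conv k w) t = conv l (conv (fun _ => 1) f) t := by
      refine conv_congr_right ht.1.le ht.2.le ?_
      filter_upwards [hkw] with s hs
      rw [hs, conv_one]
    rw [e4, e1, e5, ← e2]
    congr 1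
    funext s
    exact conv_comm _ _ _)
  filter_upwards [this] with t ht using sub_eq_zero.1 ht

/-- The average of `k` over `[t, t + δ]`. -/
noncomputable def shiftAvg (k : ℝ → ℝ) (δ t : ℝ) : ℝ := δ⁻¹ * ∫ x in t..(t + δ), k x

/-- The decrement of `k` over `[t, t + δ]`, divided by `δ`. -/
noncomputable def shiftDecr (k : ℝ → ℝ) (δ t : ℝ) : ℝ := δ⁻¹ * (k t - k (t + δ))

/-- The kernel `q` for which `∂ₜ(shiftAvg k δ * w) = q * f` whenever `w = l * f`. -/
noncomputable def approxKernel (k l : ℝ → ℝ) (δ t : ℝ) : ℝ :=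
  shiftAvg k δ 0 * l t - conv (shiftDecr k δ) l t

/-! ### The regularized kernel and its approximate identity -/

namespace IsPC

variable {k l : ℝ → ℝ} {δ t : ℝ}

theorem intervalIntegrable (h : IsPC k l) {a b : ℝ} (ha : 0 ≤ a) (hb : 0 ≤ b) :
    IntervalIntegrable k volume a b := by
  rw [intervalIntegrable_iff]
  exact (h.locInt_k.integrableOn_compact_subset (t := uIcc a b)
    (fun x hx => (le_min ha hb).trans hx.1) isCompact_uIcc).mono_set uIoc_subset_uIcc

theorem intervalIntegrable_shift (h : IsPC k l) (hδ : 0 ≤ δ) {a b : ℝ} (ha : 0 ≤ a)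
    (hb : 0 ≤ b) : IntervalIntegrable (fun x => k (x + δ)) volume a b :=
  (h.intervalIntegrable (a := a + δ) (b := b + δ) (by linarith) (by linarith)).comp_add_right δ
    |> fun h => by simpa using h

theorem integral_nonneg (h : IsPC k l) (ht : 0 ≤ t) : 0 ≤ ∫ s in (0 : ℝ)..t, k s := by
  rw [intervalIntegral_eq_timeMeasure ht]
  refine integral_nonneg_of_ae ?_
  filter_upwards [ae_mem_timeMeasure t] with s hs using h.nonneg_k s hs.1

theorem shiftAvg_nonneg (h : IsPC k l) (hδ : 0 < δ) (ht : 0 ≤ t) : 0 ≤ shiftAvg k δ t := by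
  refine mul_nonneg (inv_nonneg.2 hδ.le) ?_
  rw [intervalIntegral.integral_of_le (by linarith)]
  exact setIntegral_nonneg measurableSet_Ioc fun x hx => h.nonneg_k x (ht.trans_lt hx.1)

theorem shiftAvg_le (h : IsPC k l) (hδ : 0 < δ) (ht : 0 < t) : shiftAvg k δ t ≤ k t := by
  have := intervalIntegral.integral_mono_on (a := t) (b := t + δ) (by linarith)
    (h.intervalIntegrable ht.le (by linarith)) (intervalIntegrable_const (c := k t))
    fun x hx => h.antitone_k ht (ht.trans_le hx.1) hx.1
  rw [intervalIntegral.integral_const, add_sub_cancel_left, smul_eq_mul] at this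
  rw [shiftAvg, inv_mul_le_iff₀ hδ]
  exact this

theorem le_shiftAvg (h : IsPC k l) (hδ : 0 < δ) (ht : 0 < t) : k (t + δ) ≤ shiftAvg k δ t := by
  have := intervalIntegral.integral_mono_on (a := t) (b := t + δ) (by linarith)
    (intervalIntegrable_const (c := k (t + δ))) (h.intervalIntegrable ht.le (by linarith))
    fun x hx => h.antitone_k (ht.trans_le hx.1) (show (0 : ℝ) < t + δ by linarith) hx.2
  rw [intervalIntegral.integral_const, add_sub_cancel_left, smul_eq_mul] at this
  rw [shiftAvg, le_inv_mul_iff₀ hδ]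
  exact this

/-- A monotone function has only countably many discontinuities; elsewhere the average is squeezed
between `k(t + δ)` and `k(t)`. -/
theorem ae_tendsto_shiftAvg (h : IsPC k l) {δ : ℕ → ℝ} (hδ : ∀ n, 0 < δ n)
    (hδ0 : Tendsto δ atTop (𝓝 0)) (T : ℝ) :
    ∀ᵐ t ∂(timeMeasure T), Tendsto (fun n => shiftAvg k (δ n) t) atTop (𝓝 (k t)) := by
  have hc := h.antitone_k.countable_not_continuousWithinAt
  have hae : ∀ᵐ t : ℝ, t ∉ {x ∈ Ioi 0 | ¬ContinuousWithinAt k (Ioi 0) x} :=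
    (hc.measure_zero volume) |> measure_eq_zero_iff_ae_notMem.1
  rw [ae_timeMeasure_iff]
  filter_upwards [hae] with t ht htT
  have hcont : ContinuousWithinAt k (Ioi 0) t := by
    by_contra hn
    exact ht ⟨htT.1, hn⟩
  have h1 : Tendsto (fun n => k (t + δ n)) atTop (𝓝 (k t)) := by
    refine hcont.tendsto.comp (tendsto_nhdsWithin_iff.2 ⟨?_, ?_⟩)
    · simpa using hδ0.const_add t
    · exact Eventually.of_forall fun n => show 0 < t + δ n by linarith [hδ n, htT.1]
  exact tendsto_of_tendsto_of_tendsto_of_le_of_le h1 tendsto_const_nhds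
    (fun n => h.le_shiftAvg (hδ n) htT.1) fun n => h.shiftAvg_le (hδ n) htT.1

theorem shiftDecr_nonneg (h : IsPC k l) (hδ : 0 < δ) (ht : 0 < t) : 0 ≤ shiftDecr k δ t :=
  mul_nonneg (inv_nonneg.2 hδ.le)
    (sub_nonneg.2 (h.antitone_k ht (show (0 : ℝ) < t + δ by linarith) (by linarith)))

theorem intervalIntegrable_shiftDecr (h : IsPC k l) (hδ : 0 < δ) (ht : 0 ≤ t) :
    IntervalIntegrable (shiftDecr k δ) volume 0 t :=
  ((h.intervalIntegrable le_rfl ht).sub (h.intervalIntegrable_shift hδ.le le_rfl ht)).const_mul _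

theorem integrable_shiftDecr (h : IsPC k l) (hδ : 0 < δ) (ht : 0 ≤ t) :
    Integrable (shiftDecr k δ) (timeMeasure t) :=
  (intervalIntegrable_iff_timeMeasure ht _).1 (h.intervalIntegrable_shiftDecr hδ ht)

theorem integral_shiftDecr (h : IsPC k l) (hδ : 0 < δ) (ht : 0 ≤ t) :
    ∫ s in (0 : ℝ)..t, shiftDecr k δ s = shiftAvg k δ 0 - shiftAvg k δ t := by
  have h1 := intervalIntegral.integral_interval_sub_interval_comm
    (h.intervalIntegrable (a := 0) (b := t) le_rfl ht)
    (h.intervalIntegrable (a := δ) (b := t + δ) hδ.le (by linarith))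
    (h.intervalIntegrable (a := 0) (b := δ) le_rfl hδ.le)
  simp only [shiftDecr, shiftAvg]
  rw [intervalIntegral.integral_const_mul, intervalIntegral.integral_sub
    (h.intervalIntegrable le_rfl ht) (h.intervalIntegrable_shift hδ.le le_rfl ht),
    intervalIntegral.integral_comp_add_right (fun x => k x), zero_add, h1, mul_sub]

theorem continuousOn_shiftAvg (h : IsPC k l) (hδ : 0 < δ) (ht : 0 ≤ t) :
    ContinuousOn (shiftAvg k δ) (Icc 0 t) := by
  have h1 := intervalIntegral.continuousOn_primitive_interval'
    (h.intervalIntegrable_shiftDecr hδ ht) left_mem_uIcc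
  rw [uIcc_of_le ht] at h1
  refine (continuousOn_const (c := shiftAvg k δ 0)|>.sub h1).congr fun s hs => ?_
  rw [Pi.sub_apply, h.integral_shiftDecr hδ hs.1, sub_sub_cancel]

theorem intervalIntegrable_shiftAvg (h : IsPC k l) (hδ : 0 < δ) (ht : 0 ≤ t) :
    IntervalIntegrable (shiftAvg k δ) volume 0 t :=
  ContinuousOn.intervalIntegrable (by rw [uIcc_of_le ht]; exact h.continuousOn_shiftAvg hδ ht)

theorem integral_shiftAvg_le (h : IsPC k l) (hδ : 0 < δ) (ht : 0 ≤ t) :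
    ∫ s in (0 : ℝ)..t, shiftAvg k δ s ≤ ∫ s in (0 : ℝ)..t, k s :=
  intervalIntegral.integral_mono_on_of_le_Ioo ht (h.intervalIntegrable_shiftAvg hδ ht)
    (h.intervalIntegrable le_rfl ht) fun _ hx => h.shiftAvg_le hδ hx.1

theorem mul_shiftAvg_le (h : IsPC k l) (hδ : 0 < δ) (ht : 0 < t) :
    t * shiftAvg k δ t ≤ ∫ s in (0 : ℝ)..t, k s := by
  have := intervalIntegral.integral_mono_on_of_le_Ioo ht.le (intervalIntegrable_const (c := k t))
    (h.intervalIntegrable le_rfl ht.le) fun x hx => h.antitone_k hx.1 ht hx.2.le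
  rw [intervalIntegral.integral_const, sub_zero, smul_eq_mul] at this
  exact (mul_le_mul_of_nonneg_left (h.shiftAvg_le hδ ht) ht.le).trans this

/-- Integration by parts gives `∫₀ᵗ s p_δ(s) ds = ∫₀ᵗ k_δ - t k_δ(t)`, bounded by `∫₀ᵗ k` uniformly
in `δ`. -/
theorem integral_mul_shiftDecr_le (h : IsPC k l) (hδ : 0 < δ) (ht : 0 ≤ t) :
    ∫ s in (0 : ℝ)..t, s * shiftDecr k δ s ≤ ∫ s in (0 : ℝ)..t, k s := by
  have hp := h.intervalIntegrable_shiftDecr hδ ht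
  have h1 := integral_conv ht le_rfl (integrable_const (1 : ℝ)) (h.integrable_shiftDecr hδ ht)
  have h2 : ∫ s in (0 : ℝ)..t, conv (fun _ => (1 : ℝ)) (shiftDecr k δ) s
      = ∫ s in (0 : ℝ)..t, (shiftAvg k δ 0 - shiftAvg k δ s) := by
    refine intervalIntegral.integral_congr fun s hs => ?_
    rw [uIcc_of_le ht] at hs
    simp only [conv_one, h.integral_shiftDecr hδ hs.1]
  have hsp : IntervalIntegrable (fun s => s * shiftDecr k δ s) volume 0 t :=
    hp.continuousOn_mul continuousOn_id
  have h3 : conv (fun r => ∫ _ in (0 : ℝ)..r, (1 : ℝ)) (shiftDecr k δ) t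
      = t * (shiftAvg k δ 0 - shiftAvg k δ t) - ∫ s in (0 : ℝ)..t, s * shiftDecr k δ s := by
    rw [← h.integral_shiftDecr hδ ht, ← intervalIntegral.integral_const_mul,
      ← intervalIntegral.integral_sub (hp.const_mul t) hsp, conv]
    refine intervalIntegral.integral_congr fun s _ => ?_
    simp only [intervalIntegral.integral_const, smul_eq_mul]
    ring
  rw [h2, h3, intervalIntegral.integral_sub intervalIntegrable_const
    (h.intervalIntegrable_shiftAvg hδ ht), intervalIntegral.integral_const, smul_eq_mul] at h1
  have h4 := h.integral_shiftAvg_le hδ ht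
  have h5 := mul_nonneg ht (h.shiftAvg_nonneg hδ ht)
  linarith

theorem intervalIntegrable_conv (h : IsPC k l) (ht : 0 < t) :
    IntervalIntegrable (fun s => k (t - s) * l s) volume 0 t := by
  -- A non-integrable integrand would make the integral take its default value `0`, not `1`.
  by_contra hn
  have := intervalIntegral.integral_undef hn
  have h1 := h.conv_eq_one t ht
  simp only [conv, smul_eq_mul] at h1
  linarith

/-- Since `k * ℓ` equals `1` at both `t` and `t + δ`, `δ (p_δ * ℓ)(t) = ∫_t^{t+δ} k(t + δ - s) ℓ(s)
ds`. As `ℓ` is nonincreasing, this is at most `ℓ(t) ∫₀^δ k = δ k_δ(0) ℓ(t)`. -/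
theorem approxKernel_nonneg (h : IsPC k l) (hδ : 0 < δ) (ht : 0 < t) :
    0 ≤ approxKernel k l δ t := by
  have i1 := h.intervalIntegrable_conv ht
  have i2 := h.intervalIntegrable_conv (t := t + δ) (by linarith)
  have i3 : IntervalIntegrable (fun s => k (t + δ - s) * l s) volume 0 t :=
    i2.mono_set (by
      rw [uIcc_of_le ht.le, uIcc_of_le (by linarith)]
      exact Icc_subset_Icc_right (by linarith))
  have i4 : IntervalIntegrable (fun s => k (t + δ - s) * l s) volume t (t + δ) :=
    i2.mono_set (by
      rw [uIcc_of_le (by linarith), uIcc_of_le (by linarith)]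
      exact Icc_subset_Icc_left ht.le)
  have e1 : conv (shiftDecr k δ) l t
      = δ⁻¹ * (1 - ∫ s in (0 : ℝ)..t, k (t + δ - s) * l s) := by
    rw [← h.conv_eq_one t ht]
    simp only [conv, smul_eq_mul]
    rw [← intervalIntegral.integral_sub i1 i3, ← intervalIntegral.integral_const_mul]
    refine intervalIntegral.integral_congr fun s _ => ?_
    simp only [shiftDecr, show t - s + δ = t + δ - s by ring]
    ring
  have e2 := h.conv_eq_one (t + δ) (by linarith)
  simp only [conv, smul_eq_mul] at e2
  rw [← intervalIntegral.integral_add_adjacent_intervals i3 i4] at e2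
  have i5 : IntervalIntegrable (fun s => k (t + δ - s)) volume t (t + δ) := by
    have := (h.intervalIntegrable (a := 0) (b := δ) le_rfl hδ.le).comp_sub_left (t + δ)
    simpa using this.symm
  have e3 := intervalIntegral.integral_mono_on_of_le_Ioo (by linarith) i4 (i5.mul_const (l t))
    fun s hs => mul_le_mul_of_nonneg_left (h.antitone_l ht (ht.trans hs.1) hs.1.le)
      (h.nonneg_k _ (by linarith [hs.2]))
  rw [intervalIntegral.integral_mul_const,
    intervalIntegral.integral_comp_sub_left (fun x => k x)] at e3
  simp only [sub_self, add_sub_cancel_left] at e3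
  rw [approxKernel, e1, shiftAvg, zero_add, mul_assoc, ← mul_sub]
  exact mul_nonneg (inv_nonneg.2 hδ.le) (by linarith)

theorem integrable_approxKernel (h : IsPC k l) (hδ : 0 < δ) (ht : 0 ≤ t) :
    Integrable (approxKernel k l δ) (timeMeasure t) :=
  ((h.symm.integrable_left t).const_mul _).sub
    (integrable_conv (h.integrable_shiftDecr hδ ht) (h.symm.integrable_left t))

theorem integrable_shiftAvg_mul (h : IsPC k l) (hδ : 0 < δ) (ht : 0 ≤ t) {E : Type*}
    [NormedAddCommGroup E] [NormedSpace ℝ E] {c : ℝ → E} (hc : Integrable c (timeMeasure t)) :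
    IntervalIntegrable (fun s => shiftAvg k δ (t - s) • c s) volume 0 t := by
  rw [← intervalIntegrable_iff_timeMeasure ht] at hc
  refine hc.continuousOn_smul ((h.continuousOn_shiftAvg hδ ht).comp
    (continuous_const.sub continuous_id).continuousOn fun s hs => ?_)
  rw [uIcc_of_le ht] at hs
  exact ⟨by simpa using hs.2, by simpa using hs.1⟩

/-- `∂ₜ(shiftAvg k δ * c) = shiftAvg k δ 0 • c - shiftDecr k δ * c` in integrated form. -/
theorem integral_sub_conv_shiftDecr (h : IsPC k l) (hδ : 0 < δ) (ht : 0 ≤ t) {E : Type*}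
    [NormedAddCommGroup E] [NormedSpace ℝ E] [CompleteSpace E] {c : ℝ → E}
    (hc : Integrable c (timeMeasure t)) :
    ∫ s in (0 : ℝ)..t, (shiftAvg k δ 0 • c s - conv (shiftDecr k δ) c s)
      = conv (shiftAvg k δ) c t := by
  have hp := h.integrable_shiftDecr hδ ht
  have hci := (intervalIntegrable_iff_timeMeasure ht c).2 hc
  have hκ : IntervalIntegrable (fun s => shiftAvg k δ 0 • c s) volume 0 t := hci.smul _
  rw [intervalIntegral.integral_sub hκ
    ((intervalIntegrable_iff_timeMeasure ht _).2 (integrable_conv hp hc)),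
    integral_conv ht le_rfl hp hc, sub_eq_iff_eq_add, conv, conv,
    ← intervalIntegral.integral_add (h.integrable_shiftAvg_mul hδ ht hc)]
  · refine intervalIntegral.integral_congr fun s hs => ?_
    rw [uIcc_of_le ht] at hs
    simp only [h.integral_shiftDecr hδ (sub_nonneg.2 hs.2), ← add_smul, add_sub_cancel]
  · refine (hκ.sub (h.integrable_shiftAvg_mul hδ ht hc)).congr_uIoo ?_
    intro s hs
    rw [uIoo_of_le ht] at hs
    simp only [h.integral_shiftDecr hδ (sub_nonneg.2 hs.2.le), ← sub_smul]

theorem integral_approxKernel (h : IsPC k l) (hδ : 0 < δ) (ht : 0 ≤ t) :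
    ∫ s in (0 : ℝ)..t, approxKernel k l δ s = conv (shiftAvg k δ) l t :=
  h.integral_sub_conv_shiftDecr hδ ht (h.symm.integrable_left t)

theorem integral_approxKernel_le (h : IsPC k l) (hδ : 0 < δ) (ht : 0 < t) :
    ∫ s in (0 : ℝ)..t, approxKernel k l δ s ≤ 1 := by
  rw [h.integral_approxKernel hδ ht.le, ← h.conv_eq_one t ht]
  refine intervalIntegral.integral_mono_on_of_le_Ioo ht.le
    (h.integrable_shiftAvg_mul hδ ht.le (h.symm.integrable_left t))
    (h.intervalIntegrable_conv ht) fun s hs => ?_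
  exact mul_le_mul_of_nonneg_right (h.shiftAvg_le hδ (by linarith [hs.2])) (h.nonneg_l s hs.1)

/-- Dominated convergence, with `k_δ ≤ k` giving the majorant; hence integrability of `k(t - ·) c`
at this particular `t` is required. -/
theorem tendsto_conv_shiftAvg (h : IsPC k l) {δ : ℕ → ℝ} (hδ : ∀ n, 0 < δ n)
    (hδ0 : Tendsto δ atTop (𝓝 0)) (ht : 0 ≤ t) {E : Type*} [NormedAddCommGroup E]
    [NormedSpace ℝ E] {c : ℝ → E} (hc : Integrable c (timeMeasure t))
    (hkc : IntervalIntegrable (fun s => k (t - s) • c s) volume 0 t) :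
    Tendsto (fun n => conv (shiftAvg k (δ n)) c t) atTop (𝓝 (conv k c t)) := by
  simp only [conv, intervalIntegral_eq_timeMeasure ht]
  rw [intervalIntegrable_iff_timeMeasure ht] at hkc
  refine tendsto_integral_of_dominated_convergence _ (fun n => ?_) hkc.norm (fun n => ?_) ?_
  · exact ((intervalIntegrable_iff_timeMeasure ht _).1
      (h.integrable_shiftAvg_mul (hδ n) ht hc)).aestronglyMeasurable
  · filter_upwards [ae_mem_timeMeasure t] with s hs
    have hts : 0 < t - s := by linarith [hs.2]
    rw [norm_smul, norm_smul, Real.norm_of_nonneg (h.shiftAvg_nonneg (hδ n) hts.le),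
      Real.norm_of_nonneg (h.nonneg_k _ hts)]
    exact mul_le_mul_of_nonneg_right (h.shiftAvg_le (hδ n) hts) (norm_nonneg _)
  · filter_upwards [ae_timeMeasure_reflect (h.ae_tendsto_shiftAvg hδ hδ0 t)] with s hs
    exact hs.smul_const _

theorem tendsto_integral_approxKernel (h : IsPC k l) {δ : ℕ → ℝ} (hδ : ∀ n, 0 < δ n)
    (hδ0 : Tendsto δ atTop (𝓝 0)) (ht : 0 < t) :
    Tendsto (fun n => ∫ s in (0 : ℝ)..t, approxKernel k l (δ n) s) atTop (𝓝 1) := by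
  simp only [fun n => h.integral_approxKernel (hδ n) ht.le]
  rw [← h.conv_eq_one t ht]
  exact h.tendsto_conv_shiftAvg hδ hδ0 ht.le (h.symm.integrable_left t)
    (h.intervalIntegrable_conv ht)

theorem ae_approxKernel_conv (h : IsPC k l) (hδ : 0 < δ) (ht : 0 ≤ t) {E : Type*}
    [NormedAddCommGroup E] [NormedSpace ℝ E] [CompleteSpace E] {w f : ℝ → E}
    (hf : Integrable f (timeMeasure t)) (hwf : ∀ᵐ s ∂(timeMeasure t), w s = conv l f s) :
    ∀ᵐ s ∂(timeMeasure t), conv (approxKernel k l δ) f s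
      = shiftAvg k δ 0 • w s - conv (shiftDecr k δ) w s := by
  have hl := h.symm.integrable_left t
  have hp := h.integrable_shiftDecr hδ ht
  filter_upwards [ae_conv_conv hp hl hf, hwf, ae_intervalIntegrable_conv hl hf,
    ae_intervalIntegrable_conv (integrable_conv hp hl) hf, ae_mem_timeMeasure t]
    with s h1 h2 h3 h4 hs
  have e : conv (shiftDecr k δ) w s = conv (shiftDecr k δ) (conv l f) s :=
    conv_congr_right hs.1.le hs.2.le hwf
  have h3' : IntervalIntegrable (fun r => shiftAvg k δ 0 • l (s - r) • f r) volume 0 s :=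
    h3.smul _
  rw [e, ← h1, h2, conv, conv, conv, ← intervalIntegral.integral_smul,
    ← intervalIntegral.integral_sub h3' h4]
  simp only [approxKernel, sub_smul, mul_smul]

end IsPC

/-! ### Approximate identities acting on `L²` pairings -/

section ApproximateIdentity

theorem tendsto_integral_mul_of_approx {t M : ℝ} (ht : 0 < t) {q : ℕ → ℝ → ℝ} {G : ℝ → ℝ}
    (hqi : ∀ n, Integrable (q n) (timeMeasure t)) (hq0 : ∀ n, ∀ s, 0 < s → 0 ≤ q n s)
    (hq1 : ∀ s ∈ Ioc 0 t, Tendsto (fun n => ∫ r in (0 : ℝ)..s, q n r) atTop (𝓝 1))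
    (hG : Continuous G) (hM : ∀ r, |G r| ≤ M) :
    Tendsto (fun n => ∫ r in (0 : ℝ)..t, q n r * G r) atTop (𝓝 (G 0)) := by
  have hqii : ∀ n, IntervalIntegrable (q n) volume 0 t := fun n =>
    (intervalIntegrable_iff_timeMeasure ht.le _).2 (hqi n)
  have hM0 : 0 ≤ M := (abs_nonneg _).trans (hM 0)
  rw [Metric.tendsto_atTop]
  intro ε hε
  obtain ⟨η, hη, hηG⟩ := Metric.continuousAt_iff.1 hG.continuousAt (ε / 4) (by positivity)
  set x := min (η / 2) t with hx
  have hx0 : 0 < x := lt_min (by positivity) ht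
  have hxt : x ≤ t := min_le_right _ _
  have hxη : x < η := (min_le_left _ _).trans_lt (by linarith)
  -- The three terms bound the error near `0`, the error on `[x, t]`, where the mass of `q n` tends
  -- to `0`, and the defect of the total mass.
  have hlim : Tendsto (fun n => ε / 4 * (∫ r in (0 : ℝ)..t, q n r)
      + 2 * M * ((∫ r in (0 : ℝ)..t, q n r) - ∫ r in (0 : ℝ)..x, q n r)
      + |G 0| * |(∫ r in (0 : ℝ)..t, q n r) - 1|) atTop (𝓝 (ε / 4)) := by
    have h1 := hq1 t ⟨ht, le_rfl⟩
    have h2 := hq1 x ⟨hx0, hxt⟩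
    have := ((h1.const_mul (ε / 4)).add ((h1.sub h2).const_mul (2 * M))).add
      ((h1.sub_const 1).abs.const_mul |G 0|)
    simpa using this
  obtain ⟨N, hN⟩ := Metric.tendsto_atTop.1 hlim (ε / 4) (by positivity)
  refine ⟨N, fun n hn => ?_⟩
  have hNn := hN n hn
  rw [Real.dist_eq, abs_lt] at hNn
  have i0x : IntervalIntegrable (q n) volume 0 x := (hqii n).mono_set (by
    rw [uIcc_of_le hx0.le, uIcc_of_le ht.le]; exact Icc_subset_Icc_right hxt)
  have ixt : IntervalIntegrable (q n) volume x t := (hqii n).mono_set (by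
    rw [uIcc_of_le hxt, uIcc_of_le ht.le]; exact Icc_subset_Icc_left hx0.le)
  have hGc : Continuous fun r => G r - G 0 := hG.sub continuous_const
  have j0x : IntervalIntegrable (fun r => q n r * (G r - G 0)) volume 0 x :=
    i0x.mul_continuousOn hGc.continuousOn
  have jxt : IntervalIntegrable (fun r => q n r * (G r - G 0)) volume x t :=
    ixt.mul_continuousOn hGc.continuousOn
  have e1 : (∫ r in (0 : ℝ)..t, q n r * G r) - G 0
      = (∫ r in (0 : ℝ)..x, q n r * (G r - G 0)) + (∫ r in x..t, q n r * (G r - G 0))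
        + G 0 * ((∫ r in (0 : ℝ)..t, q n r) - 1) := by
    rw [intervalIntegral.integral_add_adjacent_intervals j0x jxt]
    simp only [mul_sub]
    rw [intervalIntegral.integral_sub ((hqii n).mul_continuousOn hG.continuousOn)
      ((hqii n).mul_const _), intervalIntegral.integral_mul_const]
    ring
  have b1 : |∫ r in (0 : ℝ)..x, q n r * (G r - G 0)| ≤ ε / 4 * ∫ r in (0 : ℝ)..x, q n r := by
    rw [← intervalIntegral.integral_const_mul, ← Real.norm_eq_abs]
    refine intervalIntegral.norm_integral_le_of_norm_le hx0.le (ae_of_all _ fun r hr => ?_)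
      (i0x.const_mul _)
    have : dist (G r) (G 0) < ε / 4 := hηG (by
      rw [Real.dist_eq, sub_zero, abs_of_pos hr.1]; exact hr.2.trans_lt hxη)
    rw [norm_mul, Real.norm_of_nonneg (hq0 n r hr.1), ← dist_eq_norm, mul_comm]
    exact mul_le_mul_of_nonneg_right this.le (hq0 n r hr.1)
  have b2 : |∫ r in x..t, q n r * (G r - G 0)| ≤ 2 * M * ∫ r in x..t, q n r := by
    rw [← intervalIntegral.integral_const_mul, ← Real.norm_eq_abs]
    refine intervalIntegral.norm_integral_le_of_norm_le hxt (ae_of_all _ fun r hr => ?_)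
      (ixt.const_mul _)
    have hr0 := hq0 n r (hx0.trans hr.1)
    rw [norm_mul, Real.norm_of_nonneg hr0, Real.norm_eq_abs, mul_comm]
    refine mul_le_mul_of_nonneg_right ?_ hr0
    linarith [abs_sub (G r) (G 0), hM r, hM 0]
  have e2 := intervalIntegral.integral_add_adjacent_intervals i0x ixt
  have hxtq : 0 ≤ ∫ r in x..t, q n r :=
    intervalIntegral.integral_nonneg hxt fun r hr => hq0 n r (hx0.trans_le hr.1)
  rw [Real.dist_eq, e1]
  refine (abs_add_three _ _ _).trans_lt ?_
  rw [abs_mul (G 0)]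
  have : ε / 4 * (∫ r in (0 : ℝ)..x, q n r) ≤ ε / 4 * ∫ r in (0 : ℝ)..t, q n r :=
    mul_le_mul_of_nonneg_left (by linarith) (by positivity)
  have e3 : (∫ r in (0 : ℝ)..t, q n r) - (∫ r in (0 : ℝ)..x, q n r) = ∫ r in x..t, q n r := by
    linarith
  rw [e3] at hNn
  linarith [hNn.2]

variable {H : Type*} [NormedAddCommGroup H] [InnerProductSpace ℝ H]

theorem memLp_comp_sub {E : Type*} [NormedAddCommGroup E] {f : ℝ → E} (hf : MemLp f 2 volume) (r : ℝ) :
    MemLp (fun s => f (s - r)) 2 volume :=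
  hf.comp_measurePreserving (measurePreserving_sub_right volume r)

theorem integrable_inner {μ : Measure ℝ} {f g : ℝ → H} (hf : MemLp f 2 μ) (hg : MemLp g 2 μ) :
    Integrable (fun s => inner ℝ (f s) (g s)) μ := by
  refine (hf.norm.integrable_mul hg.norm).mono (hf.1.inner hg.1) (ae_of_all _ fun s => ?_)
  simpa using abs_real_inner_le_norm (f s) (g s)

/-- Translations act continuously on `L²`, and the correlation is the inner product of a translate
of `f` with `g`. -/
theorem continuous_integral_inner_sub {f g : ℝ → H} (hf : MemLp f 2 volume)
    (hg : MemLp g 2 volume) :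
    Continuous fun r : ℝ => ∫ s, inner ℝ (f (s - r)) (g s) := by
  have hc : Continuous fun r : ℝ =>
      inner ℝ ((DomAddAct.mk (-r) : ℝᵈᵃᵃ) +ᵥ hf.toLp f) (hg.toLp g) := by
    have : Fact ((2 : ENNReal) ≠ ⊤) := ⟨ENNReal.ofNat_ne_top⟩
    have hv : Continuous fun r : ℝ => (DomAddAct.mk (-r) : ℝᵈᵃᵃ) :=
      DomAddAct.continuous_mk.comp continuous_neg
    exact (continuous_vadd.comp (hv.prodMk (continuous_const (y := hf.toLp f)))).inner
      continuous_const
  refine hc.congr fun r => ?_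
  rw [L2.inner_def]
  refine integral_congr_ae ?_
  have h1 := DomAddAct.vadd_Lp_ae_eq (DomAddAct.mk (-r) : ℝᵈᵃᵃ) (hf.toLp f)
  have h2 := (measurePreserving_sub_right volume r).quasiMeasurePreserving.ae hf.coeFn_toLp
  filter_upwards [h1, h2, hg.coeFn_toLp] with s e1 e2 e3
  rw [e1, e3, ← e2]
  simp [sub_eq_neg_add]

theorem integral_norm_inner_sub_le {f g : ℝ → H} (hf : MemLp f 2 volume)
    (hg : MemLp g 2 volume) (r : ℝ) :
    ∫ s, ‖(inner ℝ (f (s - r)) (g s) : ℝ)‖ ≤ (∫ s, ‖f s‖ ^ 2) + ∫ s, ‖g s‖ ^ 2 := by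
  have hfr := memLp_comp_sub hf r
  have i1 : Integrable fun s => ‖f (s - r)‖ ^ 2 := hfr.integrable_norm_pow (by norm_num)
  have i2 : Integrable fun s => ‖g s‖ ^ 2 := hg.integrable_norm_pow (by norm_num)
  rw [← integral_sub_right_eq_self (fun s => ‖f s‖ ^ 2) r, ← integral_add i1 i2]
  refine integral_mono (integrable_inner hfr hg).norm (i1.add i2) fun s => ?_
  have := abs_real_inner_le_norm (f (s - r)) (g s)
  simp only [Real.norm_eq_abs]
  nlinarith [sq_nonneg (‖f (s - r)‖ - ‖g s‖), sq_nonneg (‖f (s - r)‖), sq_nonneg ‖g s‖]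

open scoped Convolution in
-- Fubini reduces the pairing of `q * f` with `g` to integrating `q` against the bounded continuous
-- correlation of `f` and `g`, a scalar approximate-identity problem.
theorem integral_inner_convolution [CompleteSpace H] {q : ℝ → ℝ} {f g : ℝ → H}
    (hq : Integrable q) (hfi : Integrable f) (hf : MemLp f 2 volume) (hg : MemLp g 2 volume) :
    Integrable (fun s => inner ℝ ((q ⋆[ContinuousLinearMap.lsmul ℝ ℝ, volume] f) s) (g s)) ∧
    ∫ s, inner ℝ ((q ⋆[ContinuousLinearMap.lsmul ℝ ℝ, volume] f) s) (g s)
      = ∫ r, q r * ∫ s, inner ℝ (f (s - r)) (g s) := by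
  have hm : AEStronglyMeasurable
      (fun p : ℝ × ℝ => inner ℝ (q p.2 • f (p.1 - p.2)) (g p.1)) (volume.prod volume) :=
    (hq.1.convolution_integrand (ContinuousLinearMap.lsmul ℝ ℝ) hf.1).inner hg.1.comp_fst
  have hint : Integrable
      (fun p : ℝ × ℝ => inner ℝ (q p.2 • f (p.1 - p.2)) (g p.1)) (volume.prod volume) := by
    rw [integrable_prod_iff' hm]
    constructor
    · refine ae_of_all _ fun r => ?_
      simp only [real_inner_smul_left]
      exact (integrable_inner (memLp_comp_sub hf r) hg).const_mul _
    · refine (hq.norm.mul_const ((∫ s, ‖f s‖ ^ 2) + ∫ s, ‖g s‖ ^ 2)).mono'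
        (hm.norm.prod_swap.integral_prod_right') (ae_of_all _ fun r => ?_)
      simp only [real_inner_smul_left, norm_mul, integral_const_mul]
      rw [norm_norm, Real.norm_of_nonneg (integral_nonneg fun s => norm_nonneg _)]
      exact mul_le_mul_of_nonneg_left (integral_norm_inner_sub_le hf hg r) (norm_nonneg _)
  have hae : (fun s => inner ℝ ((q ⋆[ContinuousLinearMap.lsmul ℝ ℝ, volume] f) s) (g s))
      =ᵐ[volume] fun s => ∫ r, inner ℝ (q r • f (s - r)) (g s) := by
    filter_upwards [Integrable.ae_convolution_exists (ContinuousLinearMap.lsmul ℝ ℝ) hq hfi]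
      with s hs
    have hs' : Integrable fun r => q r • f (s - r) := hs
    rw [convolution_lsmul, real_inner_comm, ← integral_inner hs']
    simp only [real_inner_comm (g s)]
  refine ⟨hint.integral_prod_left.congr hae.symm, ?_⟩
  rw [integral_congr_ae hae, integral_integral_swap hint]
  simp only [real_inner_smul_left, integral_const_mul]

theorem inner_conv_timeMeasure [CompleteSpace H] {t : ℝ} {q : ℝ → ℝ}
    {f g : ℝ → H} (hq : Integrable q (timeMeasure t)) (hf : MemLp f 2 (timeMeasure t))
    (hg : MemLp g 2 (timeMeasure t)) :
    Integrable (fun s => inner ℝ (conv q f s) (g s)) (timeMeasure t) ∧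
    ∫ s, inner ℝ (conv q f s) (g s) ∂(timeMeasure t)
      = ∫ r, q r * (∫ s, inner ℝ ((Ioo 0 t).indicator f (s - r)) ((Ioo 0 t).indicator g s))
          ∂(timeMeasure t) := by
  have hfi := integrable_timeMeasure_iff.1 (hf.integrable (by norm_num))
  have hf' : MemLp ((Ioo 0 t).indicator f) 2 volume :=
    (memLp_indicator_iff_restrict measurableSet_Ioo).2 hf
  have hg' : MemLp ((Ioo 0 t).indicator g) 2 volume :=
    (memLp_indicator_iff_restrict measurableSet_Ioo).2 hg
  have key := integral_inner_convolution (integrable_timeMeasure_iff.1 hq) hfi hf' hg'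
  have e : (fun s => (inner ℝ (MeasureTheory.convolution ((Ioo 0 t).indicator q)
        ((Ioo 0 t).indicator f) (ContinuousLinearMap.lsmul ℝ ℝ) volume s)
        ((Ioo 0 t).indicator g s) : ℝ))
      = (Ioo 0 t).indicator fun s => inner ℝ (conv q f s) (g s) := by
    funext s
    by_cases hs : s ∈ Ioo 0 t
    · rw [indicator_of_mem hs, indicator_of_mem hs, conv_eq_convolution hs.1.le hs.2.le]
    · rw [indicator_of_notMem hs, indicator_of_notMem hs, inner_zero_right]
  rw [e] at key
  refine ⟨integrable_timeMeasure_iff.2 key.1, ?_⟩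
  have h2 := key.2
  rw [integral_indicator measurableSet_Ioo] at h2
  rw [timeMeasure, h2, ← integral_indicator measurableSet_Ioo]
  congr 1
  funext r
  by_cases hr : r ∈ Ioo 0 t
  · rw [indicator_of_mem hr, indicator_of_mem hr]
  · rw [indicator_of_notMem hr, indicator_of_notMem hr, zero_mul]

theorem tendsto_integral_inner_conv [CompleteSpace H] {t : ℝ} (ht : 0 < t) {q : ℕ → ℝ → ℝ}
    (hqi : ∀ n, Integrable (q n) (timeMeasure t)) (hq0 : ∀ n, ∀ s, 0 < s → 0 ≤ q n s)
    (hq1 : ∀ s ∈ Ioc 0 t, Tendsto (fun n => ∫ r in (0 : ℝ)..s, q n r) atTop (𝓝 1))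
    {f g : ℝ → H} (hf : MemLp f 2 (timeMeasure t)) (hg : MemLp g 2 (timeMeasure t)) :
    Tendsto (fun n => ∫ s in (0 : ℝ)..t, inner ℝ (conv (q n) f s) (g s)) atTop
      (𝓝 (∫ s in (0 : ℝ)..t, inner ℝ (f s) (g s))) := by
  have hf' : MemLp ((Ioo 0 t).indicator f) 2 volume :=
    (memLp_indicator_iff_restrict measurableSet_Ioo).2 hf
  have hg' : MemLp ((Ioo 0 t).indicator g) 2 volume :=
    (memLp_indicator_iff_restrict measurableSet_Ioo).2 hg
  have h := tendsto_integral_mul_of_approx ht hqi hq0 hq1 (continuous_integral_inner_sub hf' hg')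
    (fun r => (norm_integral_le_integral_norm _).trans (integral_norm_inner_sub_le hf' hg' r))
  have e0 : ∫ s, (inner ℝ ((Ioo 0 t).indicator f (s - 0)) ((Ioo 0 t).indicator g s) : ℝ)
      = ∫ s in (0 : ℝ)..t, inner ℝ (f s) (g s) := by
    rw [intervalIntegral_eq_timeMeasure ht.le, timeMeasure, ← integral_indicator measurableSet_Ioo]
    congr 1
    funext s
    by_cases hs : s ∈ Ioo 0 t
    · rw [sub_zero, indicator_of_mem hs, indicator_of_mem hs, indicator_of_mem hs]
    · rw [indicator_of_notMem hs, indicator_of_notMem hs, inner_zero_right]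
  rw [e0] at h
  refine h.congr fun n => ?_
  rw [intervalIntegral_eq_timeMeasure ht.le, intervalIntegral_eq_timeMeasure ht.le,
    (inner_conv_timeMeasure (hqi n) hf hg).2]

end ApproximateIdentity

/-! ### Lower bounds for convex functionals and the use of (A1) -/

section Functionals

variable {H : Type*} [NormedAddCommGroup H] [InnerProductSpace ℝ H]

theorem IsProperLscConvex.coe_toReal {ψ : H → EReal} (hψ : IsProperLscConvex ψ) {z : H}
    (hz : z ∈ effDomain ψ) : ((ψ z).toReal : EReal) = ψ z :=
  EReal.coe_toReal (ne_of_lt hz) (hψ.ne_bot z)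

/-- Lower semicontinuity bounds `ψ` from below on a ball about `x₀`; convexity along the segment
from `x₀` to `z` carries this bound out to `z`, with a loss linear in the distance. -/
theorem IsProperLscConvex.exists_lower_bound {ψ : H → EReal} (hψ : IsProperLscConvex ψ) :
    ∃ C : ℝ, 0 ≤ C ∧ ∀ z ∈ effDomain ψ, -(C * (1 + ‖z‖)) ≤ (ψ z).toReal := by
  obtain ⟨x₀, hx₀⟩ := hψ.proper
  set X₀ := (ψ x₀).toReal with hX₀
  have h1 : ((X₀ - 1 : ℝ) : EReal) < ψ x₀ := by
    rw [← hψ.coe_toReal hx₀]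
    exact_mod_cast sub_one_lt X₀
  obtain ⟨ρ, hρ, hball⟩ := Metric.eventually_nhds_iff.1 (hψ.lsc x₀ _ h1)
  refine ⟨|X₀| + 2 + 2 / ρ * (1 + ‖x₀‖), by positivity, fun z hz => ?_⟩
  set d := ‖z - x₀‖ with hd
  set θ := ρ / (2 * (ρ + d)) with hθ
  have hd0 : 0 ≤ d := norm_nonneg _
  have hθ0 : 0 < θ := by positivity
  have hθ1 : θ ≤ 1 := by
    rw [hθ, div_le_one (by positivity)]
    linarith
  have hy : (1 - θ) • x₀ + θ • z = x₀ + θ • (z - x₀) := by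
    rw [sub_smul, smul_sub, one_smul]; abel
  have hdist : dist ((1 - θ) • x₀ + θ • z) x₀ < ρ := by
    rw [hy, dist_eq_norm, add_sub_cancel_left, norm_smul, Real.norm_of_nonneg hθ0.le, ← hd, hθ,
      div_mul_eq_mul_div, div_lt_iff₀ (by positivity)]
    nlinarith
  have h2 := hball hdist
  have h3 := hψ.convex x₀ z (1 - θ) θ (by linarith) hθ0.le (by ring)
  rw [← hψ.coe_toReal hx₀, ← hψ.coe_toReal hz] at h3
  have h4 : X₀ - 1 < (1 - θ) * X₀ + θ * (ψ z).toReal := by exact_mod_cast h2.trans_le h3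
  have h5 : θ * (X₀ - (ψ z).toReal) < 1 := by linarith
  have h6 : X₀ - (ψ z).toReal < 2 + 2 / ρ * d := by
    have : 2 + 2 / ρ * d = θ⁻¹ := by
      rw [hθ]; field_simp
    rw [this, inv_eq_one_div, lt_div_iff₀ hθ0, mul_comm]
    exact h5
  have h7 : d ≤ ‖z‖ + ‖x₀‖ := norm_sub_le _ _
  have h8 : 2 / ρ * d ≤ 2 / ρ * (‖z‖ + ‖x₀‖) := mul_le_mul_of_nonneg_left h7 (by positivity)
  have h9 : 0 ≤ 2 / ρ := by positivity
  nlinarith [neg_abs_le X₀, abs_nonneg X₀, norm_nonneg z, norm_nonneg x₀,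
    mul_nonneg (abs_nonneg X₀) (norm_nonneg z),
    mul_nonneg (mul_nonneg h9 (norm_nonneg z)) (norm_nonneg x₀)]

/-- The condition (A1) with the constant `c`. -/
def CondA1With (T c : ℝ) (φ : ℝ → H → EReal) : Prop :=
  ∀ s ∈ Icc (0 : ℝ) T, ∀ t ∈ Icc (0 : ℝ) T, s ≤ t →
    ∀ z ∈ effDomain (φ s), ∃ z' ∈ effDomain (φ t),
      ‖z' - z‖ ≤ c * |t - s| * Real.sqrt (1 + |(φ s z).toReal|) ∧
      φ t z' ≤ (((φ s z).toReal + c * |t - s| * (1 + |(φ s z).toReal|) : ℝ) : EReal)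

variable {T c : ℝ} {φ : ℝ → H → EReal}

theorem CondA1With.exists_local_lower_bound (hA : CondA1With T c φ) (hc : 0 ≤ c)
    (hφ : ∀ t ∈ Icc (0 : ℝ) T, IsProperLscConvex (φ t)) {t : ℝ} (ht : t ∈ Icc 0 T) :
    ∃ C τ : ℝ, 0 ≤ C ∧ 0 < τ ∧ ∀ r ∈ Icc 0 t, t - τ ≤ r → ∀ z ∈ effDomain (φ r),
      -(C * (1 + ‖z‖)) ≤ (φ r z).toReal := by
  obtain ⟨C, hC, hlow⟩ := (hφ t ht).exists_lower_bound
  -- The choice of `τ` gives `c |t - r| ≤ 1/2`, so when `φʳ(z) < 0` the errors of (A1) are absorbed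
  -- by part of `φʳ(z)` itself.
  refine ⟨3 * (1 + C + C ^ 2), 1 / (2 * (c + 1)), by positivity, by positivity,
    fun r hr htr z hz => ?_⟩
  have hrT : r ∈ Icc 0 T := ⟨hr.1, hr.2.trans ht.2⟩
  obtain ⟨z', hz', h1, h2⟩ := hA r hrT t ht hr.2 z hz
  have h3 := hlow z' hz'
  rw [← (hφ t ht).coe_toReal hz', EReal.coe_le_coe_iff] at h2
  set x := (φ r z).toReal
  rcases le_or_gt 0 x with hx | hx
  · exact le_trans (neg_nonpos.2 (by positivity)) hx
  have hcd : c * |t - r| ≤ 1 / 2 := by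
    rw [abs_of_nonneg (by linarith [hr.2])]
    have : t - r ≤ 1 / (2 * (c + 1)) := by linarith
    calc c * (t - r) ≤ c * (1 / (2 * (c + 1))) := mul_le_mul_of_nonneg_left this hc
      _ ≤ 1 / 2 := by
        rw [mul_one_div, div_le_div_iff₀ (by positivity) (by norm_num)]
        linarith
  rw [abs_of_neg hx] at h1 h2
  set q := Real.sqrt (1 + -x) with hq
  have hq0 : 0 ≤ q := Real.sqrt_nonneg _
  have hqq : q ^ 2 = 1 + -x := Real.sq_sqrt (by linarith)
  have h4 : ‖z' - z‖ ≤ 1 / 2 * q := h1.trans (mul_le_mul_of_nonneg_right hcd hq0)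
  have h5 : c * |t - r| * (1 + -x) ≤ 1 / 2 * (1 + -x) :=
    mul_le_mul_of_nonneg_right hcd (by linarith)
  have h6 : ‖z'‖ ≤ ‖z‖ + 1 / 2 * q := by
    have := norm_add_le z (z' - z)
    rw [add_sub_cancel] at this
    linarith
  have h7 : C * (1 + ‖z'‖) ≤ C * (1 + ‖z‖ + 1 / 2 * q) :=
    mul_le_mul_of_nonneg_left (by linarith) hC
  have h8 : C * q ≤ C ^ 2 + (1 + -x) / 4 := by
    rw [← hqq]; nlinarith [sq_nonneg (C - q / 2)]
  have h9 := norm_nonneg z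
  nlinarith [mul_nonneg hC h9, mul_nonneg (sq_nonneg C) h9]

/-- The subgradient inequality is tested at the point `z'` that (A1) assigns to `z`. The remainder
`(ξ, z' - z)` is split by Young's inequality, which produces the `1/(4ε)`. -/
theorem CondA1With.inner_ge (hA : CondA1With T c φ) (hc : 0 ≤ c)
    (hφ : ∀ t ∈ Icc (0 : ℝ) T, IsProperLscConvex (φ t)) {s t : ℝ} (hs : s ∈ Icc 0 T)
    (ht : t ∈ Icc 0 T) (hst : s ≤ t) {z y ξ : H} (hz : z ∈ effDomain (φ s))
    (hy : y ∈ effDomain (φ t)) (hξ : ξ ∈ subdiff (φ t) y) {ε : ℝ} (hε : 0 < ε) :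
    (φ t y).toReal - (φ s z).toReal
        - c * (t - s) * ((1 + 1 / (4 * ε)) * (1 + |(φ s z).toReal|) + ε * ‖ξ‖ ^ 2)
      ≤ inner ℝ (y - z) ξ := by
  obtain ⟨z', hz', h1, h2⟩ := hA s hs t ht hst z hz
  have h3 := (hξ z' hz').trans h2
  rw [← (hφ t ht).coe_toReal hy, ← EReal.coe_add, EReal.coe_le_coe_iff] at h3
  rw [abs_of_nonneg (sub_nonneg.2 hst)] at h1 h3
  set x := (φ s z).toReal
  set q := Real.sqrt (1 + |x|) with hq
  have hqq : q ^ 2 = 1 + |x| := Real.sq_sqrt (by positivity)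
  have h4 : -(‖ξ‖ * ‖z' - z‖) ≤ inner ℝ ξ (z' - z) :=
    neg_le_of_abs_le (abs_real_inner_le_norm ξ (z' - z))
  have h5 : ‖ξ‖ * ‖z' - z‖ ≤ c * (t - s) * (‖ξ‖ * q) :=
    (mul_le_mul_of_nonneg_left h1 (norm_nonneg ξ)).trans_eq (by ring)
  have h6 : ‖ξ‖ * q ≤ ε * ‖ξ‖ ^ 2 + 1 / (4 * ε) * (1 + |x|) := by
    rw [← hqq]
    have : ε * ‖ξ‖ ^ 2 + 1 / (4 * ε) * q ^ 2 - ‖ξ‖ * q = ε * (‖ξ‖ - q / (2 * ε)) ^ 2 := by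
      field_simp; ring
    nlinarith [mul_nonneg hε.le (sq_nonneg (‖ξ‖ - q / (2 * ε)))]
  have h7 : c * (t - s) * (‖ξ‖ * q) ≤ c * (t - s) * (ε * ‖ξ‖ ^ 2 + 1 / (4 * ε) * (1 + |x|)) :=
    mul_le_mul_of_nonneg_left h6 (mul_nonneg hc (sub_nonneg.2 hst))
  have h8 : inner ℝ (y - z) ξ = inner ℝ ξ (z' - z) - inner ℝ ξ (z' - y) := by
    rw [← inner_sub_right, sub_sub_sub_cancel_left, real_inner_comm]
  rw [h8]
  nlinarith

end Functionals

/-! ### Convergence of convolutions with `k` at a prescribed time -/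

section Kernel

variable {k l : ℝ → ℝ} {δ t : ℝ}

namespace IsPC

theorem shiftAvg_le_shiftAvg_zero (h : IsPC k l) (hδ : 0 < δ) (ht : 0 ≤ t) :
    shiftAvg k δ t ≤ shiftAvg k δ 0 := by
  have h1 := h.integral_shiftDecr hδ ht
  have h2 : 0 ≤ ∫ s in (0 : ℝ)..t, shiftDecr k δ s := by
    rw [intervalIntegral_eq_timeMeasure ht]
    refine integral_nonneg_of_ae ?_
    filter_upwards [ae_mem_timeMeasure t] with s hs using h.shiftDecr_nonneg hδ hs.1
  linarith

/-- Fatou's lemma along `k_δ → k`. -/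
theorem intervalIntegrable_mul_of_nonneg (h : IsPC k l) {δ : ℕ → ℝ} (hδ : ∀ n, 0 < δ n)
    (hδ0 : Tendsto δ atTop (𝓝 0)) (ht : 0 ≤ t) {ψ : ℝ → ℝ} (hψ : Integrable ψ (timeMeasure t))
    (hψ0 : ∀ᵐ s ∂(timeMeasure t), 0 ≤ ψ s) {B : ℝ}
    (hB : ∀ n, conv (shiftAvg k (δ n)) ψ t ≤ B) :
    IntervalIntegrable (fun s => k (t - s) * ψ s) volume 0 t := by
  have hi : ∀ n, Integrable (fun s => shiftAvg k (δ n) (t - s) * ψ s) (timeMeasure t) := fun n =>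
    (intervalIntegrable_iff_timeMeasure ht _).1 (h.integrable_shiftAvg_mul (hδ n) ht hψ)
  rw [intervalIntegrable_iff_timeMeasure ht]
  refine integrable_of_tendsto (G := fun n s => shiftAvg k (δ n) (t - s) * ψ s) ?_
    (fun n => (hi n).aestronglyMeasurable) (ne_top_of_le_ne_top (ENNReal.ofReal_ne_top (r := B))
      (liminf_le_of_le (by isBoundedDefault) fun b hb => ?_))
  · filter_upwards [ae_timeMeasure_reflect (h.ae_tendsto_shiftAvg hδ hδ0 t)] with s hs
    exact hs.mul_const _
  · obtain ⟨n, hn⟩ := hb.exists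
    refine hn.trans ?_
    have h0 : 0 ≤ᵐ[timeMeasure t] fun s => shiftAvg k (δ n) (t - s) * ψ s := by
      filter_upwards [hψ0, ae_mem_timeMeasure t] with s hs hst
      exact mul_nonneg (h.shiftAvg_nonneg (hδ n) (by linarith [hst.2])) hs
    rw [← ofReal_integral_norm_eq_lintegral_enorm (hi n)]
    refine ENNReal.ofReal_le_ofReal ?_
    refine le_trans (le_of_eq ?_) (hB n)
    rw [conv, intervalIntegral_eq_timeMeasure ht]
    refine integral_congr_ae ?_
    filter_upwards [h0] with s hs using Real.norm_of_nonneg hs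

theorem intervalIntegrable_mul_of_le (h : IsPC k l) {δ : ℕ → ℝ} (hδ : ∀ n, 0 < δ n)
    (hδ0 : Tendsto δ atTop (𝓝 0)) (ht : 0 ≤ t) {ψ η : ℝ → ℝ}
    (hψ : Integrable ψ (timeMeasure t)) (hη : Integrable η (timeMeasure t))
    (hkη : IntervalIntegrable (fun s => k (t - s) * η s) volume 0 t)
    (hη0 : ∀ᵐ s ∂(timeMeasure t), 0 ≤ η s) (hψη : ∀ᵐ s ∂(timeMeasure t), -η s ≤ ψ s) {B : ℝ}
    (hB : ∀ n, conv (shiftAvg k (δ n)) ψ t ≤ B) :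
    IntervalIntegrable (fun s => k (t - s) * ψ s) volume 0 t := by
  have h1 := h.intervalIntegrable_mul_of_nonneg hδ hδ0 ht (ψ := fun s => ψ s + η s) (hψ.add hη)
    (by filter_upwards [hψη] with s hs; linarith) (B := B + conv k η t) (fun n => by
      have e : conv (shiftAvg k (δ n)) (fun s => ψ s + η s) t
          = conv (shiftAvg k (δ n)) ψ t + conv (shiftAvg k (δ n)) η t := by
        simp only [conv, smul_add]
        exact intervalIntegral.integral_add (h.integrable_shiftAvg_mul (hδ n) ht hψ)
          (h.integrable_shiftAvg_mul (hδ n) ht hη)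
      rw [e]
      refine add_le_add (hB n) ?_
      simp only [conv, smul_eq_mul, intervalIntegral_eq_timeMeasure ht]
      refine integral_mono_ae ((intervalIntegrable_iff_timeMeasure ht _).1
        (h.integrable_shiftAvg_mul (hδ n) ht hη))
        ((intervalIntegrable_iff_timeMeasure ht _).1 hkη) ?_
      filter_upwards [hη0, ae_mem_timeMeasure t] with s hs hst
      exact mul_le_mul_of_nonneg_right (h.shiftAvg_le (hδ n) (by linarith [hst.2])) hs)
  refine (h1.sub hkη).congr_uIoo fun s _ => ?_
  simp only
  ring

/-- The regularized convolutions are bounded: `k_δ * (ℓ * f) = (k_δ * ℓ) * f ≤ ∫ f`, because `k_δ *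
ℓ ≤ k * ℓ = 1`. Boundedness of `k_δ` makes the associativity valid at the given `t`. -/
theorem intervalIntegrable_mul_conv (h : IsPC k l) (ht : 0 ≤ t) {f : ℝ → ℝ}
    (hf : Integrable f (timeMeasure t)) (hf0 : ∀ s, 0 ≤ f s) :
    IntervalIntegrable (fun s => k (t - s) * conv l f s) volume 0 t := by
  have hδ : ∀ n : ℕ, (0 : ℝ) < 1 / ((n : ℝ) + 1) := fun n => by positivity
  have hl := h.symm.integrable_left t
  refine h.intervalIntegrable_mul_of_nonneg hδ tendsto_one_div_add_atTop_nhds_zero_nat ht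
    (integrable_conv hl hf) ?_ (B := ∫ s in (0 : ℝ)..t, f s) fun n => ?_
  · filter_upwards [ae_mem_timeMeasure t] with s hs
    rw [conv, intervalIntegral_eq_timeMeasure hs.1.le]
    refine integral_nonneg_of_ae ?_
    filter_upwards [ae_mem_timeMeasure s] with r hr
    exact mul_nonneg (h.nonneg_l _ (by linarith [hr.2])) (hf0 r)
  · have ha : Integrable (shiftAvg k (1 / ((n : ℝ) + 1))) (timeMeasure t) :=
      (intervalIntegrable_iff_timeMeasure ht _).1 (h.intervalIntegrable_shiftAvg (hδ n) ht)
    have hal : ∀ s, 0 < s → conv (shiftAvg k (1 / ((n : ℝ) + 1))) l s ≤ 1 := fun s hs => by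
      rw [← h.integral_approxKernel (hδ n) hs.le]
      exact h.integral_approxKernel_le (hδ n) hs
    rw [← conv_conv_of_bound (T := t) (C := shiftAvg k (1 / ((n : ℝ) + 1)) 0) ht le_rfl ha
      (fun x hx => by
        rw [Real.norm_of_nonneg (h.shiftAvg_nonneg (hδ n) hx.1.le)]
        exact h.shiftAvg_le_shiftAvg_zero (hδ n) hx.1.le) hl hf, conv,
      intervalIntegral_eq_timeMeasure ht, intervalIntegral_eq_timeMeasure ht]
    refine integral_mono_of_nonneg ?_ hf ?_
    · filter_upwards [ae_mem_timeMeasure t] with s hs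
      refine mul_nonneg ?_ (hf0 s)
      rw [← h.integral_approxKernel (hδ n) (by linarith [hs.2]),
        intervalIntegral_eq_timeMeasure (by linarith [hs.2])]
      refine integral_nonneg_of_ae ?_
      filter_upwards [ae_mem_timeMeasure (t - s)] with r hr
        using h.approxKernel_nonneg (hδ n) hr.1
    · filter_upwards [ae_mem_timeMeasure t] with s hs
      rw [smul_eq_mul]
      exact mul_le_of_le_one_left (hf0 s) (hal _ (by linarith [hs.2]))

end IsPC

end Kernel

/-! ### The inequality for the regularized kernel -/

section Inequality

variable {H : Type*} [NormedAddCommGroup H] [InnerProductSpace ℝ H] [CompleteSpace H]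

/-- Rewrite `κ w(s) - (p * w)(s)` as `(κ - ∫₀ˢ p) w(s) + ∫₀ˢ p(s - r) (w(s) - w(r)) dr` and apply
the pairwise bound under the nonnegative weight `p`. -/
theorem inner_sub_conv_ge {p : ℝ → ℝ} {w : ℝ → H} {ψ : ℝ → ℝ} {ξ : H} {s κ c A E : ℝ}
    (hs : 0 ≤ s) (hp0 : ∀ r ∈ Ioo 0 s, 0 ≤ p r) (hp : IntervalIntegrable p volume 0 s)
    (hpw : IntervalIntegrable (fun r => p (s - r) • w r) volume 0 s)
    (hpψ : IntervalIntegrable (fun r => p (s - r) • ψ r) volume 0 s)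
    (hpσ : IntervalIntegrable (fun r => ((s - r) * p (s - r)) • (1 + |ψ r|)) volume 0 s)
    (hpair : ∀ᵐ r ∂(timeMeasure s),
      ψ s - ψ r - c * (s - r) * (A * (1 + |ψ r|) + E) ≤ inner ℝ (w s - w r) ξ) :
    (κ - ∫ r in (0 : ℝ)..s, p r) * inner ℝ (w s) ξ + ψ s * (∫ r in (0 : ℝ)..s, p r)
        - conv p ψ s - c * A * conv (fun r => r * p r) (fun r => 1 + |ψ r|) s
        - c * E * (∫ r in (0 : ℝ)..s, r * p r)
      ≤ inner ℝ (κ • w s - conv p w s) ξ := by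
  have e1 : inner ℝ (conv p w s) ξ = ∫ r in (0 : ℝ)..s, p (s - r) * inner ℝ (w r) ξ := by
    rw [intervalIntegrable_iff_timeMeasure hs] at hpw
    rw [conv, intervalIntegral_eq_timeMeasure hs, intervalIntegral_eq_timeMeasure hs,
      real_inner_comm, ← integral_inner hpw]
    refine integral_congr_ae (ae_of_all _ fun r => ?_)
    simp only [real_inner_smul_right, real_inner_comm ξ]
  have ipr : IntervalIntegrable (fun r => p (s - r)) volume 0 s := by
    simpa using (hp.comp_sub_left s).symm
  have hσ : IntervalIntegrable (fun r => r * p r) volume 0 s :=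
    hp.continuousOn_mul continuousOn_id
  have iσr : IntervalIntegrable (fun r => (s - r) * p (s - r)) volume 0 s := by
    simpa using (hσ.comp_sub_left s).symm
  have iin : IntervalIntegrable (fun r => p (s - r) * inner ℝ (w r) ξ) volume 0 s := by
    rw [intervalIntegrable_iff_timeMeasure hs] at hpw ⊢
    have := hpw.inner_const (𝕜 := ℝ) ξ
    simpa only [real_inner_smul_left] using this
  have e2 : ∫ r in (0 : ℝ)..s, p (s - r) = ∫ r in (0 : ℝ)..s, p r := by
    rw [intervalIntegral.integral_comp_sub_left (fun r => p r)]; simp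
  have e3 : ∫ r in (0 : ℝ)..s, (s - r) * p (s - r) = ∫ r in (0 : ℝ)..s, r * p r := by
    rw [intervalIntegral.integral_comp_sub_left (fun r => r * p r)]; simp
  have i1 := (ipr.const_mul (inner ℝ (w s) ξ - ψ s)).add
    ((hpψ.add (hpσ.const_mul (c * A))).add (iσr.const_mul (c * E)))
  have key : ∫ r in (0 : ℝ)..s, p (s - r) * inner ℝ (w r) ξ
      ≤ ∫ r in (0 : ℝ)..s, ((inner ℝ (w s) ξ - ψ s) * p (s - r)
        + ((p (s - r) • ψ r + c * A * (((s - r) * p (s - r)) • (1 + |ψ r|)))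
          + c * E * ((s - r) * p (s - r)))) := by
    rw [intervalIntegral_eq_timeMeasure hs, intervalIntegral_eq_timeMeasure hs]
    rw [intervalIntegrable_iff_timeMeasure hs] at iin i1
    refine integral_mono_ae iin i1 ?_
    filter_upwards [hpair, ae_mem_timeMeasure s] with r hr hrs
    have hp' := hp0 (s - r) ⟨by linarith [hrs.2], by linarith [hrs.1]⟩
    rw [inner_sub_left] at hr
    have := mul_le_mul_of_nonneg_left hr hp'
    simp only [smul_eq_mul]
    nlinarith
  rw [intervalIntegral.integral_add (ipr.const_mul _)
      ((hpψ.add (hpσ.const_mul (c * A))).add (iσr.const_mul (c * E))),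
    intervalIntegral.integral_add (hpψ.add (hpσ.const_mul (c * A))) (iσr.const_mul (c * E)),
    intervalIntegral.integral_add hpψ (hpσ.const_mul (c * A)),
    intervalIntegral.integral_const_mul, intervalIntegral.integral_const_mul,
    intervalIntegral.integral_const_mul, e2, e3] at key
  rw [inner_sub_left, real_inner_smul_left, e1]
  have e4 : conv p ψ s = ∫ r in (0 : ℝ)..s, p (s - r) • ψ r := rfl
  have e5 : conv (fun r => r * p r) (fun r => 1 + |ψ r|) s
    = ∫ r in (0 : ℝ)..s, ((s - r) * p (s - r)) • (1 + |ψ r|) := rfl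
  rw [e4, e5]
  linarith

/-- The chain rule inequality for the regularized kernel `shiftAvg k δ`. -/
theorem IsPC.shiftAvg_inequality {k l : ℝ → ℝ} (h : IsPC k l) {δ t c A ε φ₀ : ℝ} (hδ : 0 < δ)
    (ht : 0 ≤ t) (hc : 0 ≤ c) (hA : 0 ≤ A) (hε : 0 ≤ ε) {w f g : ℝ → H} {ψ : ℝ → ℝ}
    (hw : Integrable w (timeMeasure t)) (hf : MemLp f 2 (timeMeasure t))
    (hg : MemLp g 2 (timeMeasure t)) (hψ : Integrable ψ (timeMeasure t))
    (hwf : ∀ᵐ s ∂(timeMeasure t), w s = conv l f s)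
    (hinit : ∀ᵐ s ∂(timeMeasure t),
      ψ s - φ₀ - c * s * (A * (1 + |φ₀|) + ε * ‖g s‖ ^ 2) ≤ inner ℝ (w s) (g s))
    (hpair : ∀ᵐ s ∂(timeMeasure t), ∀ᵐ r ∂(timeMeasure s),
      ψ s - ψ r - c * (s - r) * (A * (1 + |ψ r|) + ε * ‖g s‖ ^ 2)
        ≤ inner ℝ (w s - w r) (g s)) :
    conv (shiftAvg k δ) ψ t - φ₀ * (∫ s in (0 : ℝ)..t, shiftAvg k δ s)
        - c * A * (∫ s in (0 : ℝ)..t, k s) * t * (1 + |φ₀|)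
        - 2 * c * ε * (∫ s in (0 : ℝ)..t, k s) * (∫ s in (0 : ℝ)..t, ‖g s‖ ^ 2)
        - c * A * (∫ s in (0 : ℝ)..t, k s) * (t + ∫ s in (0 : ℝ)..t, |ψ s|)
      ≤ ∫ s in (0 : ℝ)..t, inner ℝ (conv (approxKernel k l δ) f s) (g s) := by
  set N := ∫ s in (0 : ℝ)..t, k s with hN
  have hfi : Integrable f (timeMeasure t) := hf.integrable (by norm_num)
  have hp := h.integrable_shiftDecr hδ ht
  have hpi := h.intervalIntegrable_shiftDecr hδ ht
  have hσi : IntervalIntegrable (fun r => r * shiftDecr k δ r) volume 0 t :=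
    hpi.continuousOn_mul continuousOn_id
  have hσ := (intervalIntegrable_iff_timeMeasure ht _).1 hσi
  have hψ1 : Integrable (fun s => 1 + |ψ s|) (timeMeasure t) := (integrable_const 1).add hψ.abs
  have hNs : ∀ s, 0 ≤ s → s ≤ t → ∫ r in (0 : ℝ)..s, k r ≤ N := fun s hs hst => by
    rw [hN, ← intervalIntegral.integral_add_adjacent_intervals
      (h.intervalIntegrable le_rfl hs) (h.intervalIntegrable hs ht)]
    have : 0 ≤ ∫ r in s..t, k r := by
      rw [intervalIntegral.integral_of_le hst]
      exact setIntegral_nonneg measurableSet_Ioc fun r hr => h.nonneg_k r (hs.trans_lt hr.1)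
    linarith
  have hg2 : Integrable (fun s => ‖g s‖ ^ 2) (timeMeasure t) :=
    hg.integrable_norm_pow (by norm_num)
  have hcp := integrable_conv hp hψ
  have hcσ := integrable_conv hσ hψ1
  have ha := (intervalIntegrable_iff_timeMeasure ht _).1 (h.intervalIntegrable_shiftAvg hδ ht)
  have hD : Integrable (fun s => shiftAvg k δ 0 • ψ s - conv (shiftDecr k δ) ψ s)
      (timeMeasure t) := (hψ.smul (shiftAvg k δ 0)).sub hcp
  have i1 := ha.const_mul φ₀
  have i2 : Integrable (fun _ : ℝ => c * A * N * (1 + |φ₀|)) (timeMeasure t) := integrable_const _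
  have i3 := hg2.const_mul (2 * c * ε * N)
  have i4 := hcσ.const_mul (c * A)
  have hpt : ∀ᵐ s ∂(timeMeasure t),
      (shiftAvg k δ 0 • ψ s - conv (shiftDecr k δ) ψ s) - φ₀ * shiftAvg k δ s
        - c * A * N * (1 + |φ₀|) - 2 * c * ε * N * ‖g s‖ ^ 2
        - c * A * conv (fun r => r * shiftDecr k δ r) (fun r => 1 + |ψ r|) s
      ≤ inner ℝ (conv (approxKernel k l δ) f s) (g s) := by
    filter_upwards [h.ae_approxKernel_conv hδ ht hfi hwf, hinit, hpair, ae_mem_timeMeasure t,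
      ae_intervalIntegrable_conv hp hw, ae_intervalIntegrable_conv hp hψ,
      ae_intervalIntegrable_conv hσ hψ1] with s e1 h2 h3 hs j1 j2 j3
    have key := inner_sub_conv_ge (κ := shiftAvg k δ 0) (E := ε * ‖g s‖ ^ 2) hs.1.le
      (fun r hr => h.shiftDecr_nonneg hδ hr.1) (h.intervalIntegrable_shiftDecr hδ hs.1.le)
      j1 j2 j3 h3
    -- The coefficient of `w(s)` is now `k_δ(s) ≥ 0`, so the initial bound may be multiplied by it.
    -- Each of the two error weights is at most `N`, whence the factor `2` on the `‖g‖²` term.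
    rw [h.integral_shiftDecr hδ hs.1.le, sub_sub_cancel] at key
    rw [e1]
    refine le_trans ?_ key
    have a0 := h.shiftAvg_nonneg hδ hs.1.le
    have b1 := mul_le_mul_of_nonneg_left h2 a0
    have b2 := (h.mul_shiftAvg_le hδ hs.1).trans (hNs s hs.1.le hs.2.le)
    have b3 := (h.integral_mul_shiftDecr_le hδ hs.1.le).trans (hNs s hs.1.le hs.2.le)
    have hE : 0 ≤ ε * ‖g s‖ ^ 2 := by positivity
    have b4 := mul_le_mul_of_nonneg_left b3 (mul_nonneg hc hE)
    have b5 := mul_le_mul_of_nonneg_left b2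
      (mul_nonneg hc (add_nonneg (mul_nonneg hA (by positivity : 0 ≤ 1 + |φ₀|)) hE))
    rw [smul_eq_mul]
    nlinarith
  have hmono := integral_mono_ae ((((hD.sub i1).sub i2).sub i3).sub i4)
    (inner_conv_timeMeasure (h.integrable_approxKernel hδ ht) hf hg).1 hpt
  have s1 := integral_sub (((hD.sub i1).sub i2).sub i3) i4
  have s2 := integral_sub ((hD.sub i1).sub i2) i3
  have s3 := integral_sub (hD.sub i1) i2
  have s4 := integral_sub hD i1
  simp only [Pi.sub_apply] at s1 s2 s3 s4 hmono
  rw [s1, s2, s3, s4] at hmono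
  simp only [← intervalIntegral_eq_timeMeasure ht] at hmono
  rw [h.integral_sub_conv_shiftDecr hδ ht hψ] at hmono
  simp only [intervalIntegral.integral_const_mul, intervalIntegral.integral_const, sub_zero,
    smul_eq_mul] at hmono
  -- The `L¹` convolution estimate: the primitive of `r p_δ(r)` never exceeds `N`.
  have hlast : ∫ s in (0 : ℝ)..t, conv (fun r => r * shiftDecr k δ r) (fun r => 1 + |ψ r|) s
      ≤ N * (t + ∫ s in (0 : ℝ)..t, |ψ s|) := by
    rw [integral_conv ht le_rfl hσ hψ1]
    have e : t + ∫ s in (0 : ℝ)..t, |ψ s| = ∫ s in (0 : ℝ)..t, (1 + |ψ s|) := by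
      rw [intervalIntegral.integral_add intervalIntegrable_const
        ((intervalIntegrable_iff_timeMeasure ht _).2 hψ.abs)]
      simp
    rw [e, ← intervalIntegral.integral_const_mul, conv, intervalIntegral_eq_timeMeasure ht,
      intervalIntegral_eq_timeMeasure ht]
    refine integral_mono_of_nonneg ?_ (hψ1.const_mul N) ?_
    · filter_upwards [ae_mem_timeMeasure t] with s hs
      refine mul_nonneg ?_ (by positivity)
      rw [intervalIntegral_eq_timeMeasure (by linarith [hs.2])]
      refine integral_nonneg_of_ae ?_
      filter_upwards [ae_mem_timeMeasure (t - s)] with r hr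
        using mul_nonneg hr.1.le (h.shiftDecr_nonneg hδ hr.1)
    · filter_upwards [ae_mem_timeMeasure t] with s hs
      rw [smul_eq_mul]
      exact mul_le_mul_of_nonneg_right ((h.integral_mul_shiftDecr_le hδ
        (by linarith [hs.2])).trans (hNs _ (by linarith [hs.2]) (by linarith [hs.1])))
        (by positivity)
  have hlast' := mul_le_mul_of_nonneg_left hlast (mul_nonneg hc hA)
  linarith

end Inequality

/-! ### Passage to the limit and the final constants -/

section ChainRule

variable {H : Type*} [NormedAddCommGroup H] [InnerProductSpace ℝ H]

/-- `φ^•(u(•))` has a minorant `-η` on `(0, t)` whose convolution with `k` converges at `t`. -/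
theorem exists_minorant {t C τ : ℝ} {φ : ℝ → H → EReal} {k l : ℝ → ℝ} (h : IsPC k l)
    (ht : 0 < t) (hC : 0 ≤ C) (hτ : 0 < τ)
    (hlow : ∀ r ∈ Icc 0 t, t - τ ≤ r → ∀ z ∈ effDomain (φ r),
      -(C * (1 + ‖z‖)) ≤ (φ r z).toReal) {u₀ : H} {u f : ℝ → H}
    (hw : Integrable (fun s => u s - u₀) (timeMeasure t)) (hf : Integrable f (timeMeasure t))
    (hwf : ∀ᵐ s ∂(timeMeasure t), u s - u₀ = conv l f s)
    (hdom : ∀ᵐ s ∂(timeMeasure t), u s ∈ effDomain (φ s))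
    (hψ : Integrable (along φ u) (timeMeasure t)) :
    ∃ η : ℝ → ℝ, Integrable η (timeMeasure t) ∧
      IntervalIntegrable (fun s => k (t - s) * η s) volume 0 t ∧
      (∀ᵐ s ∂(timeMeasure t), 0 ≤ η s) ∧ ∀ᵐ s ∂(timeMeasure t), -η s ≤ along φ u s := by
  have hk : Integrable (fun s => k (t - s)) (timeMeasure t) := by
    rw [← intervalIntegrable_iff_timeMeasure ht.le]
    simpa using ((h.intervalIntegrable le_rfl ht.le).comp_sub_left t).symm
  have hkm : AEStronglyMeasurable (fun s => k (t - s)) (timeMeasure t) := hk.1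
  -- Here `‖u - u₀‖ ≤ ℓ * ‖f‖`, and the convolution of `k` with the right side converges at every
  -- time.
  have hkw : Integrable (fun s => k (t - s) * ‖u s - u₀‖) (timeMeasure t) := by
    refine ((intervalIntegrable_iff_timeMeasure ht.le _).1
      (h.intervalIntegrable_mul_conv ht.le hf.norm fun s => norm_nonneg _)).mono'
      (hkm.mul hw.1.norm) ?_
    filter_upwards [hwf, ae_mem_timeMeasure t,
      ae_intervalIntegrable_conv (h.symm.integrable_left t) hf.norm] with s h1 h2 h3
    have hk0 := h.nonneg_k (t - s) (by linarith [h2.2])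
    rw [norm_mul, norm_norm, Real.norm_of_nonneg hk0, h1]
    refine mul_le_mul_of_nonneg_left ?_ hk0
    refine intervalIntegral.norm_integral_le_of_norm_le h2.1.le ?_ h3
    -- The endpoint is discarded because nothing is assumed on the sign of `ℓ(0)`.
    have hne : ∀ᵐ r : ℝ, r ≠ s := by simp [ae_iff, measure_singleton]
    filter_upwards [hne] with r hrs hr
    have : 0 < s - r := sub_pos.2 (lt_of_le_of_ne hr.2 hrs)
    rw [norm_smul, Real.norm_of_nonneg (h.nonneg_l _ this), smul_eq_mul]
  have hind : Integrable ((Iio (t - τ)).indicator fun s => |along φ u s|) (timeMeasure t) :=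
    hψ.abs.indicator measurableSet_Iio
  -- Before `t - τ` the function `|ψ|` itself serves, as `k(t - s) ≤ k(τ)` there; after it, the
  -- local lower bound does.
  refine ⟨fun s => (Iio (t - τ)).indicator (fun s => |along φ u s|) s
    + C * (1 + ‖u₀‖ + ‖u s - u₀‖), hind.add (((integrable_const _).add hw.norm).const_mul C),
    ?_, ae_of_all _ fun s => ?_, ?_⟩
  · rw [intervalIntegrable_iff_timeMeasure ht.le]
    have i1 : Integrable (fun s => k (t - s) * (Iio (t - τ)).indicator
        (fun s => |along φ u s|) s) (timeMeasure t) := by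
      refine (hψ.abs.const_mul (k τ)).mono' (hkm.mul hind.1) ?_
      filter_upwards [ae_mem_timeMeasure t] with s hs
      by_cases hsτ : s < t - τ
      · rw [indicator_of_mem (show s ∈ Iio (t - τ) from hsτ), norm_mul,
          Real.norm_of_nonneg (h.nonneg_k (t - s) (by linarith [hs.2])), Real.norm_eq_abs, abs_abs]
        exact mul_le_mul_of_nonneg_right (h.antitone_k hτ (show 0 < t - s by linarith)
          (by linarith)) (abs_nonneg _)
      · rw [indicator_of_notMem (show s ∉ Iio (t - τ) from hsτ), mul_zero, norm_zero]
        exact mul_nonneg (h.nonneg_k τ hτ) (abs_nonneg _)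
    refine (i1.add (((hk.mul_const (1 + ‖u₀‖)).add hkw).const_mul C)).congr
      (ae_of_all _ fun s => ?_)
    simp only [Pi.add_apply]
    ring
  · exact add_nonneg (indicator_nonneg (fun _ _ => abs_nonneg _) s) (by positivity)
  · filter_upwards [ae_mem_timeMeasure t, hdom] with s hs hd
    have h0 : 0 ≤ C * (1 + ‖u₀‖ + ‖u s - u₀‖) := by positivity
    by_cases hsτ : s < t - τ
    · rw [indicator_of_mem (show s ∈ Iio (t - τ) from hsτ)]
      linarith [neg_abs_le (along φ u s)]
    · rw [indicator_of_notMem (show s ∉ Iio (t - τ) from hsτ), zero_add]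
      have h1 := hlow s ⟨hs.1.le, hs.2.le⟩ (not_lt.1 hsτ) (u s) hd
      have h2 : ‖u s‖ ≤ ‖u₀‖ + ‖u s - u₀‖ := by
        have := norm_add_le u₀ (u s - u₀)
        rwa [add_sub_cancel] at this
      have h3 := mul_le_mul_of_nonneg_left h2 hC
      simp only [along]
      linarith

theorem chain_rule_inequality [CompleteSpace H] {T c : ℝ} {φ : ℝ → H → EReal}
    (hφ : ∀ t ∈ Icc (0 : ℝ) T, IsProperLscConvex (φ t)) (hc : 0 ≤ c) (hA : CondA1With T c φ)
    {k l : ℝ → ℝ} (h : IsPC k l) {u₀ : H} {u g : ℝ → H} (hu₀ : u₀ ∈ effDomain (φ 0))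
    (hg : MemLp g 2 (timeMeasure T)) (hB : MemDomB T k (fun s => u s - u₀))
    (hL : MemL1Along T φ u)
    (hsub : ∀ᵐ s ∂(timeMeasure T), u s ∈ subdiffDomain (φ s) ∧ g s ∈ subdiff (φ s) (u s))
    {t : ℝ} (ht : t ∈ Ioc (0 : ℝ) T) :
    IntervalIntegrable (fun s => k (t - s) * along φ u s) volume 0 t ∧
    ∀ ε : ℝ, 0 < ε →
      conv k (along φ u) t - (φ 0 u₀).toReal * (∫ s in (0 : ℝ)..t, k s)
        - c * (1 + 1 / (4 * ε)) * (∫ s in (0 : ℝ)..t, k s) * t * (1 + |(φ 0 u₀).toReal|)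
        - 2 * c * ε * (∫ s in (0 : ℝ)..t, k s) * (∫ s in (0 : ℝ)..t, ‖g s‖ ^ 2)
        - c * (1 + 1 / (4 * ε)) * (∫ s in (0 : ℝ)..t, k s)
          * (t + ∫ s in (0 : ℝ)..t, |along φ u s|)
      ≤ ∫ s in (0 : ℝ)..t, inner ℝ (opB T k (fun r => u r - u₀) s) (g s) := by
  have hT : 0 < T := ht.1.trans_le ht.2
  have hle := timeMeasure_mono ht.2
  obtain ⟨hf, hkw⟩ := ae_eq_integral_timeDeriv hT hB.2.1 hB.2.2
  have hwT : Integrable (fun s => u s - u₀) (timeMeasure T) := hB.1.integrable (by norm_num)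
  have hwfT := h.ae_eq_conv_of_conv_eq_integral hT hwT (hf.integrable (by norm_num)) hkw
  change MemLp (opB T k fun r => u r - u₀) 2 (timeMeasure T) at hf
  change ∀ᵐ s ∂(timeMeasure T), u s - u₀ = conv l (opB T k fun r => u r - u₀) s at hwfT
  set f := opB T k fun r => u r - u₀
  have hf' := hf.mono_measure hle
  have hg' := hg.mono_measure hle
  have hw := hwT.mono_measure hle
  have hψ := hL.2.mono_measure hle
  have hwf := ae_timeMeasure_mono ht.2 hwfT
  have hfi : Integrable f (timeMeasure t) := hf'.integrable (by norm_num)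
  have hδ : ∀ n : ℕ, (0 : ℝ) < 1 / ((n : ℝ) + 1) := fun n => by positivity
  have hδ0 := tendsto_one_div_add_atTop_nhds_zero_nat (𝕜 := ℝ)
  have h0T : (0 : ℝ) ∈ Icc 0 T := ⟨le_rfl, hT.le⟩
  have hineq : ∀ ε : ℝ, 0 < ε → ∀ n : ℕ, _ := fun ε hε n =>
    h.shiftAvg_inequality (δ := 1 / ((n : ℝ) + 1)) (t := t) (c := c) (A := 1 + 1 / (4 * ε))
      (ε := ε) (φ₀ := (φ 0 u₀).toReal) (w := fun s => u s - u₀) (f := f) (g := g)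
      (ψ := along φ u) (hδ n) ht.1.le hc (by positivity) hε.le hw hf' hg' hψ hwf
      (by
        filter_upwards [ae_timeMeasure_mono ht.2 hsub, ae_mem_timeMeasure t] with s hs hst
        have := hA.inner_ge hc hφ h0T (t := s) ⟨hst.1.le, hst.2.le.trans ht.2⟩ hst.1.le hu₀
          hs.1.1 hs.2 hε
        rwa [sub_zero] at this)
      (by
        filter_upwards [ae_timeMeasure_mono ht.2 hsub, ae_mem_timeMeasure t] with s hs hst
        have hsT : s ≤ T := hst.2.le.trans ht.2
        filter_upwards [ae_timeMeasure_mono hsT hsub, ae_mem_timeMeasure s] with r hr hrs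
        have := hA.inner_ge hc hφ (s := r) (t := s) ⟨hrs.1.le, hrs.2.le.trans hsT⟩
          ⟨hst.1.le, hsT⟩ hrs.2.le hr.1.1 hs.1.1 hs.2 hε
        rwa [← sub_sub_sub_cancel_right (u s) (u r) u₀] at this)
  have hlim : Tendsto (fun n : ℕ => ∫ s in (0 : ℝ)..t,
      inner ℝ (conv (approxKernel k l (1 / ((n : ℝ) + 1))) f s) (g s)) atTop
      (𝓝 (∫ s in (0 : ℝ)..t, inner ℝ (f s) (g s))) :=
    tendsto_integral_inner_conv ht.1 (fun n => h.integrable_approxKernel (hδ n) ht.1.le)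
      (fun n s hs => h.approxKernel_nonneg (hδ n) hs)
      (fun s hs => h.tendsto_integral_approxKernel hδ hδ0 hs.1) hf' hg'
  have hlima : Tendsto (fun n : ℕ => ∫ s in (0 : ℝ)..t, shiftAvg k (1 / ((n : ℝ) + 1)) s) atTop
      (𝓝 (∫ s in (0 : ℝ)..t, k s)) := by
    have := h.tendsto_conv_shiftAvg hδ hδ0 ht.1.le (integrable_const (1 : ℝ))
      (by simpa using ((h.intervalIntegrable le_rfl ht.1.le).comp_sub_left t).symm)
    simpa only [conv_comm _ (fun _ => (1 : ℝ)), conv_one] using this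
  have hint : IntervalIntegrable (fun s => k (t - s) * along φ u s) volume 0 t := by
    obtain ⟨C, τ, hC, hτ, hlow⟩ := hA.exists_local_lower_bound hc hφ ⟨ht.1.le, ht.2⟩
    obtain ⟨η, e1, e2, e3, e4⟩ := exists_minorant h ht.1 hC hτ hlow hw hfi hwf
      (ae_timeMeasure_mono ht.2 hL.1) hψ
    -- Convergent sequences are bounded, so the regularized inequality with `ε = 1` bounds `(k_δ *
    -- ψ)(t)` uniformly in `n`.
    have hbd := ((hlim.add (hlima.const_mul (φ 0 u₀).toReal)).bddAbove_range)
    obtain ⟨B, hBd⟩ := hbd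
    refine h.intervalIntegrable_mul_of_le hδ hδ0 ht.1.le hψ e1 e2 e3 e4
      (B := B + c * (1 + 1 / (4 * 1)) * (∫ s in (0 : ℝ)..t, k s) * t * (1 + |(φ 0 u₀).toReal|)
        + 2 * c * 1 * (∫ s in (0 : ℝ)..t, k s) * (∫ s in (0 : ℝ)..t, ‖g s‖ ^ 2)
        + c * (1 + 1 / (4 * 1)) * (∫ s in (0 : ℝ)..t, k s)
          * (t + ∫ s in (0 : ℝ)..t, |along φ u s|)) fun n => ?_
    have h1 := hineq 1 one_pos n
    have h2 := hBd (mem_range_self n)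
    linarith
  refine ⟨hint, fun ε hε => ?_⟩
  have hlimψ := h.tendsto_conv_shiftAvg hδ hδ0 ht.1.le hψ hint
  exact le_of_tendsto_of_tendsto' ((((hlimψ.sub (hlima.const_mul _)).sub_const _).sub_const
    _).sub_const _) hlim (hineq ε hε)

/-- For `ε < 1`, `1 + 1/(4ε) ≤ 5/(4ε)`. The two terms in `t` then add up to at most `5/2` times
`(c/ε) K t (1 + a)`, so `3c` suffices. -/
theorem simplify_constants {c ε t N K a G P : ℝ} (hc : 0 ≤ c) (hε : ε ∈ Ioo (0 : ℝ) 1)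
    (ht : 0 ≤ t) (hN : 0 ≤ N) (hNK : N ≤ K) (ha : 0 ≤ a) (hG : 0 ≤ G) (hP : 0 ≤ P) :
    c * (1 + 1 / (4 * ε)) * N * t * (1 + a) + 2 * c * ε * N * G
        + c * (1 + 1 / (4 * ε)) * N * (t + P)
      ≤ ε * (3 * c) * K * G + 3 * c / ε * t * K * (1 + a) + 3 * c / ε * K * P := by
  have hε0 := hε.1
  have h1 : 1 + 1 / (4 * ε) ≤ 5 / 4 / ε := by
    rw [le_div_iff₀ hε0, add_mul, one_div, mul_inv, mul_assoc, inv_mul_cancel₀ hε0.ne']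
    linarith [hε.2]
  have h2 : c * (1 + 1 / (4 * ε)) * N ≤ 5 / 4 * (c / ε * K) := by
    calc c * (1 + 1 / (4 * ε)) * N ≤ c * (5 / 4 / ε) * K := by gcongr
      _ = 5 / 4 * (c / ε * K) := by ring
  have hQ : 0 ≤ c / ε * K := mul_nonneg (div_nonneg hc hε0.le) (hN.trans hNK)
  have h3 := mul_le_mul_of_nonneg_right h2 (mul_nonneg ht (by linarith : 0 ≤ 1 + a))
  have h4 := mul_le_mul_of_nonneg_right h2 (add_nonneg ht hP)
  have h5 : c * ε * N * G ≤ c * ε * K * G := by gcongr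
  have h6 : 0 ≤ c * ε * K * G :=
    mul_nonneg (mul_nonneg (mul_nonneg hc hε0.le) (hN.trans hNK)) hG
  have e1 : 3 * c / ε * t * K * (1 + a) = 3 * (c / ε * K) * (t * (1 + a)) := by ring
  have e2 : 3 * c / ε * K * P = 3 * (c / ε * K * P) := by ring
  rw [e1, e2]
  nlinarith [mul_nonneg hQ hP, mul_nonneg hQ ht, mul_nonneg (mul_nonneg hQ ht) ha]

end ChainRule

end NonlocalChainRule

open NonlocalChainRule in
theorem mainTheorem5 {H : Type*} [NormedAddCommGroup H] [InnerProductSpace ℝ H] [CompleteSpace H]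
    (T : ℝ) (hT : 0 < T) (φ : ℝ → H → EReal)
    (hφ : ∀ t ∈ Set.Icc (0 : ℝ) T, NonlocalChainRule.IsProperLscConvex (φ t))
    (hA1 : NonlocalChainRule.CondA1 T φ) (hA2 : NonlocalChainRule.CondA2 T φ) :
    -- the constant `c` does not depend on `k`, `l`, `u₀`, `u`, `g`, `ε`, `t`
    ∃ c : ℝ, 0 ≤ c ∧ ∀ k l : ℝ → ℝ, NonlocalChainRule.IsPC k l →
      (∀ (u₀ : H) (u g : ℝ → H),
        u₀ ∈ NonlocalChainRule.effDomain (φ 0) →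
        MemLp u 2 (NonlocalChainRule.timeMeasure T) →
        MemLp g 2 (NonlocalChainRule.timeMeasure T) →
        NonlocalChainRule.MemDomB T k (fun s => u s - u₀) →
        NonlocalChainRule.MemL1Along T φ u →
        (∀ᵐ s ∂(NonlocalChainRule.timeMeasure T),
          u s ∈ NonlocalChainRule.subdiffDomain (φ s) ∧
          g s ∈ NonlocalChainRule.subdiff (φ s) (u s)) →
        ∀ t ∈ Set.Ioc (0 : ℝ) T,
          -- the convolution `(k * φ^•(u(•)))(t)` is a convergent integral
          IntervalIntegrable (fun s => k (t - s) * NonlocalChainRule.along φ u s) volume 0 t ∧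
          ∀ ε ∈ Set.Ioo (0 : ℝ) 1,
            NonlocalChainRule.conv k (NonlocalChainRule.along φ u) t
                - (φ 0 u₀).toReal * (∫ s in (0 : ℝ)..t, k s)
                - ε * c * (∫ s in (0 : ℝ)..T, |k s|) * (∫ s in (0 : ℝ)..t, ‖g s‖ ^ 2)
                - c / ε * t * (∫ s in (0 : ℝ)..T, |k s|) * (1 + |(φ 0 u₀).toReal|)
                - c / ε * (∫ s in (0 : ℝ)..T, |k s|)
                    * (∫ s in (0 : ℝ)..t, |NonlocalChainRule.along φ u s|)
              ≤ ∫ s in (0 : ℝ)..t,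
                  inner ℝ (NonlocalChainRule.opB T k (fun r => u r - u₀) s) (g s)) ∧
      -- the constant `C` may depend on `k` but not on `u₀`, `u`, `g`, `ε`, `t`
      ∃ C : ℝ, 0 ≤ C ∧ ∀ (u₀ : H) (u g : ℝ → H),
        u₀ ∈ NonlocalChainRule.effDomain (φ 0) →
        MemLp u 2 (NonlocalChainRule.timeMeasure T) →
        MemLp g 2 (NonlocalChainRule.timeMeasure T) →
        NonlocalChainRule.MemDomB T k (fun s => u s - u₀) →
        NonlocalChainRule.MemL1Along T φ u →
        (∀ᵐ s ∂(NonlocalChainRule.timeMeasure T),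
          u s ∈ NonlocalChainRule.subdiffDomain (φ s) ∧
          g s ∈ NonlocalChainRule.subdiff (φ s) (u s)) →
        ∀ t ∈ Set.Ioc (0 : ℝ) T, ∀ ε ∈ Set.Ioo (0 : ℝ) 1,
          NonlocalChainRule.conv k (NonlocalChainRule.along φ u) t
              - (φ 0 u₀).toReal * (∫ s in (0 : ℝ)..t, k s)
              - ε * C * (∫ s in (0 : ℝ)..t, ‖g s‖ ^ 2)
              - C / ε * (T * (1 + |(φ 0 u₀).toReal|)
                  + ∫ s in (0 : ℝ)..t, |NonlocalChainRule.along φ u s|)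
            ≤ ∫ s in (0 : ℝ)..t,
                inner ℝ (NonlocalChainRule.opB T k (fun r => u r - u₀) s) (g s) := by
  obtain ⟨c, hc, hA⟩ := hA1
  have first : ∀ k l : ℝ → ℝ, IsPC k l → ∀ (u₀ : H) (u g : ℝ → H),
      u₀ ∈ effDomain (φ 0) → MemLp g 2 (timeMeasure T) → MemDomB T k (fun s => u s - u₀) →
      MemL1Along T φ u →
      (∀ᵐ s ∂(timeMeasure T), u s ∈ subdiffDomain (φ s) ∧ g s ∈ subdiff (φ s) (u s)) →
      ∀ t ∈ Set.Ioc (0 : ℝ) T,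
        IntervalIntegrable (fun s => k (t - s) * along φ u s) volume 0 t ∧
        ∀ ε ∈ Set.Ioo (0 : ℝ) 1,
          conv k (along φ u) t - (φ 0 u₀).toReal * (∫ s in (0 : ℝ)..t, k s)
              - ε * (3 * c) * (∫ s in (0 : ℝ)..T, |k s|) * (∫ s in (0 : ℝ)..t, ‖g s‖ ^ 2)
              - 3 * c / ε * t * (∫ s in (0 : ℝ)..T, |k s|) * (1 + |(φ 0 u₀).toReal|)
              - 3 * c / ε * (∫ s in (0 : ℝ)..T, |k s|) * (∫ s in (0 : ℝ)..t, |along φ u s|)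
            ≤ ∫ s in (0 : ℝ)..t, inner ℝ (opB T k (fun r => u r - u₀) s) (g s) := by
    intro k l hkl u₀ u g hu₀ hg hB hL hsub t ht
    obtain ⟨h1, h2⟩ := chain_rule_inequality hφ hc hA hkl hu₀ hg hB hL hsub ht
    refine ⟨h1, fun ε hε => ?_⟩
    have hNK : ∫ s in (0 : ℝ)..t, k s ≤ ∫ s in (0 : ℝ)..T, |k s| := by
      rw [intervalIntegral_eq_timeMeasure ht.1.le, intervalIntegral_eq_timeMeasure hT.le]
      refine (integral_mono (hkl.integrable_left t) (hkl.integrable_left t).abs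
        fun s => le_abs_self _).trans ?_
      exact integral_mono_measure (timeMeasure_mono ht.2)
        (Filter.Eventually.of_forall fun s => abs_nonneg _) (hkl.integrable_left T).abs
    have h3 := simplify_constants hc hε ht.1.le (hkl.integral_nonneg ht.1.le) hNK
      (abs_nonneg (φ 0 u₀).toReal)
      (intervalIntegral.integral_nonneg (μ := volume) ht.1.le fun s _ => sq_nonneg ‖g s‖)
      (intervalIntegral.integral_nonneg (μ := volume) ht.1.le
        fun s _ => abs_nonneg (along φ u s))
    linarith [h2 ε hε.1]
  refine ⟨3 * c, by positivity, fun k l hkl => ⟨fun u₀ u g hu₀ _ hg hB hL hsub =>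
    first k l hkl u₀ u g hu₀ hg hB hL hsub, ?_⟩⟩
  have hK : 0 ≤ ∫ s in (0 : ℝ)..T, |k s| :=
    intervalIntegral.integral_nonneg hT.le fun s _ => abs_nonneg _
  -- The norm of `k` is absorbed into `C`, and `t ≤ T` is used in the term with the initial energy.
  refine ⟨3 * c * ∫ s in (0 : ℝ)..T, |k s|, by positivity,
    fun u₀ u g hu₀ _ hg hB hL hsub t ht ε hε => ?_⟩
  refine le_trans ?_ ((first k l hkl u₀ u g hu₀ hg hB hL hsub t ht).2 ε hε)
  set K := ∫ s in (0 : ℝ)..T, |k s|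
  have h1 : 3 * c / ε * t * K * (1 + |(φ 0 u₀).toReal|)
      ≤ 3 * c / ε * T * K * (1 + |(φ 0 u₀).toReal|) := by
    have := hε.1
    have := ht.2
    gcongr
  have e : 3 * c * K / ε * (T * (1 + |(φ 0 u₀).toReal|)
        + ∫ s in (0 : ℝ)..t, |along φ u s|)
      = 3 * c / ε * T * K * (1 + |(φ 0 u₀).toReal|)
        + 3 * c / ε * K * ∫ s in (0 : ℝ)..t, |along φ u s| := by ring
  rw [e]
  linarith
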